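/- For a prime $p$ write $G_p = SL_2(\mathbb{Z}/p\mathbb{Z})$, and for a set $A$ of generators of $G_p$ let $\Gamma(G_p,A)$ be the Cayley graph with vertex set $G_p$ and edges $(ag,g)$, $g\in G_p$, $a\in A$, taken without orientation; so its diameter is the least $\ell$ such that every element of $G_p$ is a product of at most $\ell$ elements of $A\cup A^{-1}$. Call a real number $c>0$ admissible if there is a constant $K$ such that $\operatorname{diam}\Gamma(G_p,A)\le K(\log p)^c$ for every prime $p$ and every set $A$ of generators of $G_p$. Admissible exponents exist. Moreover, for every admissible $c$ there is a constant $C>0$ (independent of $p$, $A$, $\psi$) such that the following holds. Let $p$ be a prime and let $A$ be a set of generators of $G=G_p$. Let $\psi:G\to\mathbb{R}$ be a probability distribution on $G$ that is symmetric, i.e. $\psi(g)=\psi(g^{-1})$ for every $g\in G$, and whose support contains $A$, and let $\eta=\min_{g\in A\cup A^{-1}}\psi(g)$. Then the second largest eigenvalue (counted with multiplicity) of the transition matrix $T_\psi(G,A)=\{\psi(y^{-1}x)\}_{x,y\in G}$, whose largest eigenvalue is $1$, is at most $$1-\frac{C\,\eta}{(\log p)^{2c}}.$$ -/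

import Mathlib

/-- The Cayley graph `Γ(G, A)`: its vertices are the elements of `G`, and its edges are the pairs
`(a * g, g)` with `g ∈ G` and `a ∈ A`. Edges are taken without orientation and loops are
discarded, neither of which affects the length of a shortest path
(paths spell out words in `A ∪ A⁻¹`). -/
def cayleyGraph {G : Type*} [Group G] (A : Set G) : SimpleGraph G :=
  SimpleGraph.fromRel (fun u v => ∃ a ∈ A, u = a * v)

/-- `c > 0` is an admissible exponent in the polylogarithmic diameter bound for `SL₂(ℤ/pℤ)`:
`diam Γ(SL₂(ℤ/pℤ), A) = O((log p) ^ c)` for all primes `p` and all sets `A` of generators, with an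
implied constant `K` that depends on neither `p` nor `A`. (As `A` generates the finite group
`SL₂(ℤ/pℤ)`, the graph is finite and connected, so `SimpleGraph.diam` is its true diameter.) -/
def IsDiameterExponent (c : ℝ) : Prop :=
  0 < c ∧ ∃ K : ℝ, ∀ (p : ℕ) [Fact p.Prime] (A : Set (Matrix.SpecialLinearGroup (Fin 2) (ZMod p))),
    Subgroup.closure A = ⊤ → ((cayleyGraph A).diam : ℝ) ≤ K * Real.log p ^ c

/-- The transition matrix `T_ψ = {ψ (y⁻¹ x)}_{x, y ∈ G}`. -/
def transitionMatrix {G : Type*} [Group G] (ψ : G → ℝ) : Matrix G G ℝ :=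
  Matrix.of fun x y => ψ (y⁻¹ * x)

theorem transitionMatrix_isHermitian {G : Type*} [Group G] {ψ : G → ℝ}
    (hψ : ∀ g, ψ g = ψ g⁻¹) : (transitionMatrix ψ).IsHermitian := by
  ext x y
  simp [transitionMatrix, hψ (x⁻¹ * y)]

/-- The second largest eigenvalue, counted with multiplicity, of a real symmetric matrix with at
least two rows (`Matrix.IsHermitian.eigenvalues₀` lists the eigenvalues with multiplicity in
decreasing order, starting from index `0`). -/
noncomputable def secondLargestEigenvalue {ι : Type*} [Fintype ι] [DecidableEq ι] [Nontrivial ι]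
    {M : Matrix ι ι ℝ} (hM : M.IsHermitian) : ℝ :=
  hM.eigenvalues₀ ⟨1, Fintype.one_lt_card⟩

instance specialLinearGroup_fin_two_nontrivial {R : Type*} [CommRing R] [Nontrivial R] :
    Nontrivial (Matrix.SpecialLinearGroup (Fin 2) R) :=
  ⟨⟨⟨!![1, 1; 0, 1], by simp [Matrix.det_fin_two]⟩, 1, fun h => by
    have h01 := congrArg (fun g : Matrix.SpecialLinearGroup (Fin 2) R => g.1 0 1) h
    simp at h01⟩⟩

/-! Diameter. The engine is a product theorem, `exists_product_theorem`: a large enough symmetric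
generating set `H` containing 1 has a bounded power that is the whole group or has at least `|H| ^
(56/55)` elements. A regular semisimple class is two-dimensional inside a three-dimensional group,
and `larsen_pink` shows that a set meets such a class (of nonzero trace) in at most a constant times
the 2/3 power of the size of its eighth power. By orbit-stabilizer, either `H` grows or each regular
element of nonzero trace in `H ^ 10` has many centralizing elements in `H ^ 2`. This richness
survives conjugation by generators (`cent_conj_of_generates`), so all conjugates of one torus are
rich; a regular element lies in a single torus, so counting makes `H ^ 2` large
(`card_group_mul_le`). Once `|H|` exceeds a constant times `q ^ (11/4)`, a dot product estimate over
`F` yields all unitriangular matrices in `H ^ 12`, hence the group in `H ^ 48`.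

Iterating, the logarithm of the size is multiplied by 56/55 while the word length is multiplied by a
constant `k`. About log log p stages suffice, and the length reached is a power of log p.

Spectrum. For a mean-zero `f`, the squared distance between `f` and its translate by `g`, averaged
over `g`, is `2‖f‖²`. By the triangle inequality along a path it is at most `diam²` times the
largest value at a generator, and the Dirichlet form of `ψ` controls that value up to `1/η`. This
Poincaré inequality, applied to a mean-zero combination of the two top eigenvectors, bounds the gap
below by `η / diam²`. -/

section

open scoped MatrixGroups Pointwise

/-! ### Entrywise calculus in SL₂ and invariant lines -/

section Entries

variable {F : Type*} [Field F]

theorem sl2_det (g : SL(2, F)) : g.1 0 0 * g.1 1 1 - g.1 0 1 * g.1 1 0 = 1 := by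
  have := g.2
  rwa [Matrix.det_fin_two] at this

theorem sl2_ext {g h : SL(2, F)} (h00 : g.1 0 0 = h.1 0 0) (h01 : g.1 0 1 = h.1 0 1)
    (h10 : g.1 1 0 = h.1 1 0) (h11 : g.1 1 1 = h.1 1 1) : g = h := by
  ext i j
  fin_cases i <;> fin_cases j <;> assumption

theorem sl2_mul (g h : SL(2, F)) :
    (g * h).1 0 0 = g.1 0 0 * h.1 0 0 + g.1 0 1 * h.1 1 0 ∧
    (g * h).1 0 1 = g.1 0 0 * h.1 0 1 + g.1 0 1 * h.1 1 1 ∧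
    (g * h).1 1 0 = g.1 1 0 * h.1 0 0 + g.1 1 1 * h.1 1 0 ∧
    (g * h).1 1 1 = g.1 1 0 * h.1 0 1 + g.1 1 1 * h.1 1 1 := by
  simp [Matrix.mul_apply, Fin.sum_univ_two]

theorem sl2_inv (g : SL(2, F)) :
    (g⁻¹).1 0 0 = g.1 1 1 ∧ (g⁻¹).1 0 1 = -g.1 0 1 ∧
    (g⁻¹).1 1 0 = -g.1 1 0 ∧ (g⁻¹).1 1 1 = g.1 0 0 := by
  simp [Matrix.SpecialLinearGroup.coe_inv, Matrix.adjugate_fin_two]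

theorem sl2_one : (1 : SL(2, F)).1 0 0 = 1 ∧ (1 : SL(2, F)).1 0 1 = 0 ∧
    (1 : SL(2, F)).1 1 0 = 0 ∧ (1 : SL(2, F)).1 1 1 = 1 := by
  simp

/-- The trace of an element of `SL₂(F)`. -/
def slTrace (g : SL(2, F)) : F := g.1 0 0 + g.1 1 1

/-- The vector `(u, v)` is an eigenvector of `g` (or zero). -/
def FixesLine (g : SL(2, F)) (u v : F) : Prop :=
  (g.1 0 0 * u + g.1 0 1 * v) * v = (g.1 1 0 * u + g.1 1 1 * v) * u

theorem slTrace_conj (x g : SL(2, F)) : slTrace (x * g * x⁻¹) = slTrace g := by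
  have := sl2_det x
  simp only [slTrace, sl2_inv, sl2_mul]
  linear_combination (g.1 0 0 + g.1 1 1) * this

theorem fixesLine_one_zero (g : SL(2, F)) : FixesLine g 1 0 ↔ g.1 1 0 = 0 := by
  simp [FixesLine, eq_comm]

theorem FixesLine.exists_eigenvalue {g : SL(2, F)} {u v : F} (h : FixesLine g u v)
    (h0 : u ≠ 0 ∨ v ≠ 0) :
    ∃ l, l ≠ 0 ∧ g.1 0 0 * u + g.1 0 1 * v = l * u ∧ g.1 1 0 * u + g.1 1 1 * v = l * v := by
  have hd := sl2_det g
  unfold FixesLine at h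
  have key : ∃ l, g.1 0 0 * u + g.1 0 1 * v = l * u ∧ g.1 1 0 * u + g.1 1 1 * v = l * v := by
    rcases h0 with h0 | h0
    · refine ⟨(g.1 0 0 * u + g.1 0 1 * v) / u, by field_simp, ?_⟩
      field_simp
      linear_combination -h
    · refine ⟨(g.1 1 0 * u + g.1 1 1 * v) / v, ?_, by field_simp⟩
      field_simp
      linear_combination h
  obtain ⟨l, h1, h2⟩ := key
  refine ⟨l, ?_, h1, h2⟩
  rintro rfl
  rcases h0 with h0 | h0
  · apply h0
    linear_combination (-u) * hd + g.1 1 1 * h1 - g.1 0 1 * h2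
  · apply h0
    linear_combination (-v) * hd + g.1 0 0 * h2 - g.1 1 0 * h1

theorem FixesLine.of_eigenvalue {g : SL(2, F)} {u v l : F}
    (h1 : g.1 0 0 * u + g.1 0 1 * v = l * u) (h2 : g.1 1 0 * u + g.1 1 1 * v = l * v) :
    FixesLine g u v := by
  unfold FixesLine
  rw [h1, h2]; ring

theorem FixesLine.of_mul {g h : SL(2, F)} {u v : F} (h0 : u ≠ 0 ∨ v ≠ 0)
    (hg : FixesLine g u v) (hgh : FixesLine (g * h) u v) : FixesLine h u v := by
  obtain ⟨l, hl, h1, h2⟩ := hg.exists_eigenvalue h0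
  obtain ⟨m, -, h3, h4⟩ := hgh.exists_eigenvalue h0
  have hd := sl2_det g
  simp only [sl2_mul] at h3 h4
  have e1 : h.1 0 0 * u + h.1 0 1 * v = m * (g.1 1 1 * u - g.1 0 1 * v) := by
    linear_combination (-(h.1 0 0 * u + h.1 0 1 * v)) * hd + g.1 1 1 * h3 - g.1 0 1 * h4
  have e2 : h.1 1 0 * u + h.1 1 1 * v = m * (g.1 0 0 * v - g.1 1 0 * u) := by
    linear_combination (-(h.1 1 0 * u + h.1 1 1 * v)) * hd + g.1 0 0 * h4 - g.1 1 0 * h3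
  have e3 : u = l * (g.1 1 1 * u - g.1 0 1 * v) := by
    linear_combination (-u) * hd + g.1 1 1 * h1 - g.1 0 1 * h2
  have e4 : v = l * (g.1 0 0 * v - g.1 1 0 * u) := by
    linear_combination (-v) * hd + g.1 0 0 * h2 - g.1 1 0 * h1
  unfold FixesLine
  rw [e1, e2]
  linear_combination m * (g.1 1 1 * u - g.1 0 1 * v) * e4 - m * (g.1 0 0 * v - g.1 1 0 * u) * e3

theorem FixesLine.mul {g h : SL(2, F)} {u v : F} (h0 : u ≠ 0 ∨ v ≠ 0)
    (hg : FixesLine g u v) (hh : FixesLine h u v) : FixesLine (g * h) u v := by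
  obtain ⟨l, hl, h1, h2⟩ := hg.exists_eigenvalue h0
  obtain ⟨m, -, h3, h4⟩ := hh.exists_eigenvalue h0
  refine FixesLine.of_eigenvalue (l := l * m) ?_ ?_
  · simp only [sl2_mul]
    linear_combination m * h1 + g.1 0 0 * h3 + g.1 0 1 * h4
  · simp only [sl2_mul]
    linear_combination m * h2 + g.1 1 0 * h3 + g.1 1 1 * h4

theorem FixesLine.inv {g : SL(2, F)} {u v : F} (hg : FixesLine g u v) : FixesLine g⁻¹ u v := by
  unfold FixesLine at *
  simp only [sl2_inv]
  linear_combination -hg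

theorem fixesLine_one (u v : F) : FixesLine (1 : SL(2, F)) u v := by
  simp only [FixesLine, sl2_one]; ring

/-- The element `k` sends the first basis vector to `(u, v)`, so questions about any line reduce to
upper triangular matrices. -/
theorem fixesLine_conj {u v : F} (k g : SL(2, F)) (h0 : k.1 0 0 = u ∧ k.1 1 0 = v) :
    FixesLine g u v ↔ FixesLine (k⁻¹ * g * k) 1 0 := by
  obtain ⟨rfl, rfl⟩ := h0
  rw [fixesLine_one_zero]
  simp only [FixesLine, sl2_mul, sl2_inv]
  constructor <;> intro h <;> linear_combination -h

/-- Every nonzero vector is the first column of an element of `SL₂`. -/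
theorem exists_sl2_column {u v : F} (h0 : u ≠ 0 ∨ v ≠ 0) :
    ∃ k : SL(2, F), k.1 0 0 = u ∧ k.1 1 0 = v := by
  rcases h0 with h0 | h0
  · exact ⟨⟨!![u, 0; v, u⁻¹], by simp [Matrix.det_fin_two, h0]⟩, by simp, by simp⟩
  · exact ⟨⟨!![u, -v⁻¹; v, 0], by simp [Matrix.det_fin_two, h0]⟩, by simp, by simp⟩

/-- A monic quadratic has at most two roots. -/
theorem card_quadratic_le_two (s : Finset F) (B C : F) (h : ∀ x ∈ s, x ^ 2 + B * x + C = 0) :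
    s.card ≤ 2 := by
  by_contra! hcard
  obtain ⟨x, hx, y, hy, z, hz, hxy, hxz, hyz⟩ := Finset.two_lt_card.1 hcard
  have e1 : x + y + B = 0 := by
    apply mul_left_cancel₀ (sub_ne_zero.2 hxy)
    linear_combination h x hx - h y hy
  have e2 : x + z + B = 0 := by
    apply mul_left_cancel₀ (sub_ne_zero.2 hxz)
    linear_combination h x hx - h z hz
  apply hyz
  linear_combination e1 - e2

end Entries

/-! ### Words in symmetric sets -/

section Pow

variable {G : Type*} [Group G] [DecidableEq G]

theorem mul_mem_finset_pow {S : Finset G} {m n : ℕ} {a b : G} (ha : a ∈ S ^ m) (hb : b ∈ S ^ n) :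
    a * b ∈ S ^ (m + n) := by
  rw [pow_add]; exact Finset.mul_mem_mul ha hb

theorem inv_finset_pow {S : Finset G} (hS : S⁻¹ = S) (n : ℕ) : (S ^ n)⁻¹ = S ^ n := by
  rw [← inv_pow, hS]

theorem inv_mem_finset_pow {S : Finset G} (hS : S⁻¹ = S) {n : ℕ} {a : G} (ha : a ∈ S ^ n) :
    a⁻¹ ∈ S ^ n := by
  rw [← inv_finset_pow hS n]; exact Finset.inv_mem_inv ha

theorem inv_mul_mem_sq {S : Finset G} (hS : S⁻¹ = S) {a b : G} (ha : a ∈ S) (hb : b ∈ S) :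
    a⁻¹ * b ∈ S ^ 2 := by
  rw [pow_two]
  refine Finset.mul_mem_mul ?_ hb
  rw [← hS]; exact Finset.inv_mem_inv ha

end Pow

/-! ### Few elements of given trace fix a line -/

section Unipotent

variable {F : Type*} [Field F] [DecidableEq F]

/-- The elements of `S ^ 2` that are upper unitriangular. -/
def unipotentPart (S : Finset SL(2, F)) : Finset SL(2, F) :=
  (S ^ 2).filter fun g => g.1 1 0 = 0 ∧ g.1 0 0 = 1

/-- With `h` outside the Borel subgroup, `(a, b, c) ↦ a (h b h⁻¹) c` is injective for unitriangular
`a, b, c` with `b ≠ 1`: the lower left entry determines `b`, then the diagonal entries determine `a`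
and `c`. The words have length 2 + 4 + 2 = 8. -/
theorem unipotentPart_card {S : Finset SL(2, F)} (hS : S⁻¹ = S) {h : SL(2, F)} (hh : h ∈ S)
    (h10 : h.1 1 0 ≠ 0) :
    (unipotentPart S).card * (((unipotentPart S).card - 1) * (unipotentPart S).card)
      ≤ (S ^ 8).card := by
  have hsub : (unipotentPart S).card - 1 ≤ ((unipotentPart S).erase 1).card :=
    Finset.pred_card_le_card_erase
  refine (Nat.mul_le_mul_left _ (Nat.mul_le_mul_right _ hsub)).trans ?_
  rw [← Finset.card_product, ← Finset.card_product]
  have hh1 : h ∈ S ^ 1 := by simpa using hh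
  refine Finset.card_le_card_of_injOn (fun x => x.1 * (h * x.2.1 * h⁻¹) * x.2.2) ?_ ?_
  · rintro ⟨a, b, c⟩ hx
    simp only [Finset.coe_product, Set.mem_prod, Finset.mem_coe, unipotentPart,
      Finset.mem_erase, Finset.mem_filter] at hx
    obtain ⟨⟨ha, -⟩, ⟨-, hb, -⟩, hc, -⟩ := hx
    exact mul_mem_finset_pow (mul_mem_finset_pow ha (mul_mem_finset_pow
      (mul_mem_finset_pow hh1 hb) (inv_mem_finset_pow hS hh1))) hc
  · rintro ⟨a, b, c⟩ hx ⟨a', b', c'⟩ hx' heq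
    simp only [Finset.coe_product, Set.mem_prod, Finset.mem_coe, unipotentPart,
      Finset.mem_erase, Finset.mem_filter] at hx hx'
    obtain ⟨⟨-, ha1, ha0⟩, ⟨hb, -, hb1, hb0⟩, -, hc1, hc0⟩ := hx
    obtain ⟨⟨-, ha1', ha0'⟩, ⟨hb', -, hb1', hb0'⟩, -, hc1', hc0'⟩ := hx'
    have e {g : SL(2, F)} (h1 : g.1 1 0 = 0) (h0 : g.1 0 0 = 1) : g.1 1 1 = 1 := by
      have := sl2_det g
      rw [h1, h0] at this
      linear_combination this
    have ha2 := e ha1 ha0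
    have hb2 := e hb1 hb0
    have hc2 := e hc1 hc0
    have ha2' := e ha1' ha0'
    have hb2' := e hb1' hb0'
    have hc2' := e hc1' hc0'
    simp only at heq
    have q10 := congrArg (fun g : SL(2, F) => g.1 1 0) heq
    have q00 := congrArg (fun g : SL(2, F) => g.1 0 0) heq
    have q11 := congrArg (fun g : SL(2, F) => g.1 1 1) heq
    simp only [sl2_mul, sl2_inv, ha0, ha1, ha2, hb0, hb1, hb2, hc0, hc1, hc2, ha0', ha1', ha2',
      hb0', hb1', hb2', hc0', hc1', hc2'] at q10 q00 q11
    have hc2 : h.1 1 0 ^ 2 ≠ 0 := pow_ne_zero 2 h10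
    have hb3 : b.1 0 1 = b'.1 0 1 := by
      apply mul_left_cancel₀ hc2
      linear_combination -q10
    have hne : b.1 0 1 ≠ 0 := by
      intro h0
      apply hb
      apply sl2_ext <;> simp [hb0, hb1, hb2, h0]
    rw [← hb3] at q00 q11
    have hne2 : h.1 1 0 ^ 2 * b.1 0 1 ≠ 0 := mul_ne_zero hc2 hne
    have ha3 : a.1 0 1 = a'.1 0 1 := by
      apply mul_left_cancel₀ hne2
      linear_combination -q00
    have hc3 : c.1 0 1 = c'.1 0 1 := by
      apply mul_left_cancel₀ hne2
      linear_combination -q11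
    have hA : a = a' := sl2_ext (by rw [ha0, ha0']) ha3 (by rw [ha1, ha1']) (by rw [ha2, ha2'])
    have hB : b = b' := sl2_ext (by rw [hb0, hb0']) hb3 (by rw [hb1, hb1']) (by rw [hb2, hb2'])
    have hC : c = c' := sl2_ext (by rw [hc0, hc0']) hc3 (by rw [hc1, hc1']) (by rw [‹c.1 1 1 = 1›, hc2'])
    rw [hA, hB, hC]

/-- The trace leaves two values for the upper left entry, the roots of `l² - t l + 1`; two elements
sharing it differ by a unitriangular element of `S ^ 2`. -/
theorem card_upper_trace_le {S : Finset SL(2, F)} (hS : S⁻¹ = S) (t : F) :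
    (S.filter fun g => g.1 1 0 = 0 ∧ slTrace g = t).card ≤ (unipotentPart S).card * 2 := by
  refine (Finset.card_le_mul_card_image (f := fun g => g.1 0 0) _ (unipotentPart S).card ?_).trans
    (Nat.mul_le_mul_left _ ?_)
  · intro l hl
    rcases Finset.eq_empty_or_nonempty
      ((S.filter fun g => g.1 1 0 = 0 ∧ slTrace g = t).filter fun g => g.1 0 0 = l) with h0 | ⟨x, hx⟩
    · rw [h0]; simp
    simp only [Finset.mem_filter] at hx
    obtain ⟨⟨hxS, hx1, hxt⟩, hx0⟩ := hx
    refine Finset.card_le_card_of_injOn (fun g => x⁻¹ * g) ?_ (mul_right_injective _).injOn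
    intro g hg
    simp only [Finset.coe_filter, Set.mem_ofPred_eq, Finset.mem_filter] at hg
    obtain ⟨⟨hgS, hg1, hgt⟩, hg0⟩ := hg
    simp only [unipotentPart, Finset.coe_filter, Set.mem_ofPred_eq]
    refine ⟨inv_mul_mem_sq hS hxS hgS, ?_, ?_⟩
    · simp only [sl2_mul, sl2_inv, hx1, hg1]; ring
    · have := sl2_det x
      simp only [sl2_mul, sl2_inv, hx1, hg1, hg0] at this ⊢
      rw [hx0] at this
      linear_combination this
  · refine card_quadratic_le_two _ (-t) 1 ?_
    intro l hl
    simp only [Finset.mem_image, Finset.mem_filter] at hl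
    obtain ⟨g, ⟨-, hg1, hgt⟩, rfl⟩ := hl
    have := sl2_det g
    rw [hg1] at this
    unfold slTrace at hgt
    rw [← hgt]
    linear_combination -this

/-- After conjugating the line to the first axis, the two preceding bounds combine. This is the
one-dimensional case of Larsen–Pink. -/
theorem card_fixesLine_trace_le {S : Finset SL(2, F)} (hS : S⁻¹ = S) {u v : F}
    (h0 : u ≠ 0 ∨ v ≠ 0) {h : SL(2, F)} (hh : h ∈ S) (hf : ¬ FixesLine h u v) (t : F)
    (s : Finset SL(2, F)) (hs : ∀ g ∈ s, g ∈ S ∧ FixesLine g u v ∧ slTrace g = t) :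
    s.card ^ 3 ≤ 16 * (S ^ 8).card := by
  obtain ⟨k, hk⟩ := exists_sl2_column h0
  set f : SL(2, F) →* SL(2, F) := (MulAut.conj k⁻¹).toMonoidHom with hfdef
  have hfa (g) : f g = k⁻¹ * g * k := by simp [hfdef]
  have hinj : Function.Injective f := (MulAut.conj k⁻¹).injective
  have hS' : (S.image f)⁻¹ = S.image f := by
    rw [← Finset.image_inv (f := f), hS]
  have hM : (unipotentPart (S.image f)).card *
      (((unipotentPart (S.image f)).card - 1) * (unipotentPart (S.image f)).card)
      ≤ (S ^ 8).card := by
    refine (unipotentPart_card hS' (Finset.mem_image_of_mem f hh) ?_).trans ?_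
    · rw [hfa]
      rwa [fixesLine_conj k h hk, fixesLine_one_zero] at hf
    · rw [← Finset.image_pow]; exact Finset.card_image_le
  have hs2 : s.card ≤ (unipotentPart (S.image f)).card * 2 := by
    refine le_trans ?_ (card_upper_trace_le hS' t)
    refine Finset.card_le_card_of_injOn f ?_ hinj.injOn
    intro g hg
    obtain ⟨h1, h2, h3⟩ := hs g hg
    simp only [Finset.coe_filter, Set.mem_ofPred_eq]
    refine ⟨Finset.mem_image_of_mem f h1, ?_, ?_⟩
    · rwa [fixesLine_conj k g hk, fixesLine_one_zero, ← hfa] at h2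
    · rw [hfa]
      simpa [h3] using slTrace_conj k⁻¹ g
  have hN : 1 ≤ (S ^ 8).card := Finset.card_pos.2 (Finset.Nonempty.pow ⟨h, hh⟩)
  generalize (unipotentPart (S.image f)).card = M at hM hs2
  refine (Nat.pow_le_pow_left hs2 3).trans ?_
  -- For `M ≥ 2`, `(2M)³ ≤ 16 M² (M - 1)`; the cases `M = 0, 1` only need `1 ≤ |S ^ 8|`.
  rcases M with _ | _ | M
  · simp
  · simp; omega
  · simp only [Nat.add_sub_cancel] at hM
    nlinarith [Nat.zero_le (M * M), Nat.zero_le (M * M * M)]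

end Unipotent

/-! ### Fibres of `(x, y, w) ↦ (xy, xw)` on a trace class -/

section LarsenPink

variable {F : Type*} [Field F]

/-- A nonzero nilpotent matrix `!![p, q; r, -p]` has an image line fixed by each `g` with
`tr (g d) = 0`. -/
theorem exists_fixesLine_of_nilpotent {p q r : F} (h0 : p ≠ 0 ∨ q ≠ 0 ∨ r ≠ 0)
    (hd : p ^ 2 + q * r = 0) :
    ∃ u v : F, (u ≠ 0 ∨ v ≠ 0) ∧ ∀ g : SL(2, F),
      g.1 0 0 * p + g.1 0 1 * r + g.1 1 0 * q - g.1 1 1 * p = 0 → FixesLine g u v := by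
  by_cases hr : r = 0
  · have hp : p = 0 := by
      rw [hr] at hd
      simpa using hd
    have hq : q ≠ 0 := by
      rcases h0 with h | h | h
      · exact absurd hp h
      · exact h
      · exact absurd hr h
    refine ⟨1, 0, by simp, fun g hg => ?_⟩
    rw [fixesLine_one_zero]
    rw [hr, hp] at hg
    simpa [hq] using hg
  · refine ⟨p, r, Or.inr hr, fun g hg => ?_⟩
    unfold FixesLine
    linear_combination r * hg - g.1 1 0 * hd

/-- A non-scalar matrix has at most two eigenlines. If there are fewer over `F`, the spare witnesses
are arbitrary. -/
theorem exists_two_lines {x : SL(2, F)} (hx : slTrace x ^ 2 ≠ 4) :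
    ∃ u v u' v' : F, (u ≠ 0 ∨ v ≠ 0) ∧ (u' ≠ 0 ∨ v' ≠ 0) ∧
      ∀ a b : F, (a ≠ 0 ∨ b ≠ 0) → FixesLine x a b →
        ∀ g : SL(2, F), FixesLine g a b → FixesLine g u v ∨ FixesLine g u' v' := by
  have hd := sl2_det x
  by_cases hc : x.1 1 0 = 0
  · have hne : x.1 1 1 - x.1 0 0 ≠ 0 := by
      intro h
      apply hx
      rw [hc] at hd
      unfold slTrace
      linear_combination (x.1 1 1 - x.1 0 0) * h + 4 * hd
    refine ⟨1, 0, x.1 0 1, x.1 1 1 - x.1 0 0, by simp, Or.inr hne, ?_⟩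
    intro a b h0 hxa g hg
    unfold FixesLine at hxa
    rw [hc] at hxa
    have h1 : b * (a * (x.1 1 1 - x.1 0 0) - x.1 0 1 * b) = 0 := by linear_combination -hxa
    rcases mul_eq_zero.1 h1 with hb | hb
    · left
      subst hb
      have ha : a ≠ 0 := by simpa using h0
      rw [fixesLine_one_zero]
      unfold FixesLine at hg
      simpa [ha, eq_comm] using hg
    · right
      have hb0 : b ≠ 0 := by
        rintro rfl
        rcases h0 with h | h
        · exact h (by simpa [hne] using hb)
        · exact h rfl
      unfold FixesLine at hg ⊢
      apply mul_left_cancel₀ (pow_ne_zero 2 hb0)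
      set e := x.1 1 1 - x.1 0 0
      have hb' : x.1 0 1 * b = a * e := by linear_combination -hb
      linear_combination e ^ 2 * hg + (g.1 0 0 * e * b + g.1 0 1 * 0 - g.1 1 1 * e * b
        - g.1 1 0 * (x.1 0 1 * b + a * e)) * hb'
  · by_cases hex : ∃ z, FixesLine x z 1
    · obtain ⟨z, hz⟩ := hex
      refine ⟨z, 1, (x.1 0 0 - x.1 1 1) / x.1 1 0 - z, 1, by simp, by simp, ?_⟩
      intro a b h0 hxa g hg
      have hb : b ≠ 0 := by
        rintro rfl
        unfold FixesLine at hxa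
        have : a ≠ 0 := by simpa using h0
        exact hc (by simpa [this, eq_comm] using hxa)
      have hg' : FixesLine g (a / b) 1 := by
        unfold FixesLine at hg ⊢
        field_simp
        linear_combination hg
      have hxa' : FixesLine x (a / b) 1 := by
        unfold FixesLine at hxa ⊢
        field_simp
        linear_combination hxa
      generalize a / b = w at hg' hxa'
      have h1 : (w - z) * (w - ((x.1 0 0 - x.1 1 1) / x.1 1 0 - z)) = 0 := by
        unfold FixesLine at hxa' hz
        field_simp
        linear_combination hz - hxa'
      rcases mul_eq_zero.1 h1 with h | h
      · left; rwa [← sub_eq_zero.1 h]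
      · right; rwa [← sub_eq_zero.1 h]
    -- No eigenline over `F`: the claim is vacuous.
    · refine ⟨1, 0, 1, 0, by simp, by simp, ?_⟩
      intro a b h0 hxa g hg
      exfalso
      have hb : b ≠ 0 := by
        rintro rfl
        unfold FixesLine at hxa
        have : a ≠ 0 := by simpa using h0
        exact hc (by simpa [this, eq_comm] using hxa)
      apply hex
      refine ⟨a / b, ?_⟩
      unfold FixesLine at hxa ⊢
      field_simp
      linear_combination hxa

/-- Two elements with no common eigenvector over `F`. -/
def NoCommonLine (x y : SL(2, F)) : Prop :=
  ∀ u v : F, (u ≠ 0 ∨ v ≠ 0) → FixesLine x u v → ¬ FixesLine y u v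

/-- A linear system of rank three in four unknowns has a one-dimensional solution space. -/
theorem solutions_proportional {A : Matrix (Fin 3) (Fin 4) F} (hA : LinearIndependent F A.row)
    {d e : Fin 4 → F} (hd : A.mulVec d = 0) (he : A.mulVec e = 0) (hd0 : d ≠ 0) :
    ∃ s : F, e = s • d := by
  have hr := hA.rank_matrix
  have h := LinearMap.finrank_range_add_finrank_ker A.mulVecLin
  rw [Matrix.rank] at hr
  simp only [hr, Fintype.card_fin, Module.finrank_fin_fun] at h
  have h1 : Module.finrank F (LinearMap.ker A.mulVecLin) = 1 := by omega
  obtain ⟨s, hs⟩ := exists_smul_eq_of_finrank_eq_one h1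
    (x := ⟨d, by simpa using hd⟩) (by simpa [Subtype.ext_iff] using hd0)
    ⟨e, by simpa using he⟩
  exact ⟨s, by simpa [Subtype.ext_iff, eq_comm] using hs⟩

/-- The rows are `w`, `x⁻¹` and `y` as vectors of `M₂(F)`. Equal nonzero traces force any relation
to be affine, `w = a x⁻¹ + (1 - a) y`; the determinant then leaves only the excluded coincidences or
a nilpotent `y - x⁻¹`, whose line would be fixed by both `x` and `y`. -/
theorem linearIndependent_of_noCommonLine {t : F} (ht : t ≠ 0) {x y w : SL(2, F)}
    (hx : slTrace x = t) (hy : slTrace y = t) (hw : slTrace w = t) (hxy : NoCommonLine x y)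
    (hyx : y ≠ x⁻¹) (hwx : w ≠ x⁻¹) (hwy : w ≠ y) :
    LinearIndependent F
      ![![w.1 0 0, w.1 0 1, w.1 1 0, w.1 1 1], ![x.1 1 1, -x.1 0 1, -x.1 1 0, x.1 0 0],
        ![y.1 0 0, y.1 0 1, y.1 1 0, y.1 1 1]] := by
  have dx := sl2_det x
  have dy := sl2_det y
  have dw := sl2_det w
  unfold slTrace at hx hy hw
  have hyx' : ¬ (y.1 0 0 = x.1 1 1 ∧ y.1 0 1 = -x.1 0 1 ∧ y.1 1 0 = -x.1 1 0 ∧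
      y.1 1 1 = x.1 0 0) := by
    rintro ⟨h1, h2, h3, h4⟩
    exact hyx (sl2_ext (by simp only [sl2_inv, h1]) (by simp only [sl2_inv, h2])
      (by simp only [sl2_inv, h3]) (by simp only [sl2_inv, h4]))
  rw [show (![![w.1 0 0, w.1 0 1, w.1 1 0, w.1 1 1], ![x.1 1 1, -x.1 0 1, -x.1 1 0, x.1 0 0],
        ![y.1 0 0, y.1 0 1, y.1 1 0, y.1 1 1]] : Fin 3 → Fin 4 → F) =
        Fin.cons ![w.1 0 0, w.1 0 1, w.1 1 0, w.1 1 1] ![![x.1 1 1, -x.1 0 1, -x.1 1 0, x.1 0 0],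
        ![y.1 0 0, y.1 0 1, y.1 1 0, y.1 1 1]] from rfl, linearIndependent_finCons]
  constructor
  · rw [LinearIndependent.pair_iff]
    intro a b hab
    have e0 := congrFun hab 0
    have e1 := congrFun hab 1
    have e2 := congrFun hab 2
    have e3 := congrFun hab 3
    simp at e0 e1 e2 e3
    have hb : b = -a := by
      apply mul_right_cancel₀ ht
      linear_combination e0 + e3 - a * hx - b * hy
    subst hb
    by_cases ha : a = 0
    · simp [ha]
    · exfalso
      apply hyx'
      refine ⟨?_, ?_, ?_, ?_⟩ <;> apply mul_left_cancel₀ ha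
      · linear_combination -e0
      · linear_combination -e1
      · linear_combination -e2
      · linear_combination -e3
  · rw [show Set.range ![![x.1 1 1, -x.1 0 1, -x.1 1 0, x.1 0 0],
        ![y.1 0 0, y.1 0 1, y.1 1 0, y.1 1 1]] = {![x.1 1 1, -x.1 0 1, -x.1 1 0, x.1 0 0],
        ![y.1 0 0, y.1 0 1, y.1 1 0, y.1 1 1]} by simp [Set.pair_comm], Submodule.mem_span_pair]
    rintro ⟨a, b, hab⟩
    have e0 := congrFun hab 0
    have e1 := congrFun hab 1
    have e2 := congrFun hab 2
    have e3 := congrFun hab 3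
    simp at e0 e1 e2 e3
    have hab1 : a + b = 1 := by
      apply mul_right_cancel₀ ht
      linear_combination e0 + e3 - a * hx - b * hy + hw
    obtain rfl : b = 1 - a := by linear_combination hab1
    set τ := x.1 0 0 * y.1 0 0 + x.1 0 1 * y.1 1 0 + x.1 1 0 * y.1 0 1 + x.1 1 1 * y.1 1 1 with hτ
    -- Here `τ = tr (x y)` is the cross term of `det (a x⁻¹ + (1 - a) y)`, and all three
    -- determinants are 1.
    have key : a * (1 - a) * (τ - 2) = 0 := by
      rw [← e0, ← e1, ← e2, ← e3] at dw
      rw [hτ]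
      linear_combination dw - a ^ 2 * dx - (1 - a) ^ 2 * dy
    rcases mul_eq_zero.1 key with h | h
    · rcases mul_eq_zero.1 h with h | h
      · subst h
        apply hwy
        apply sl2_ext
        · linear_combination -e0
        · linear_combination -e1
        · linear_combination -e2
        · linear_combination -e3
      · obtain rfl : a = 1 := by linear_combination -h
        apply hwx
        apply sl2_ext <;> simp only [sl2_inv]
        · linear_combination -e0
        · linear_combination -e1
        · linear_combination -e2
        · linear_combination -e3
    · obtain ⟨u, v, huv, hfix⟩ := exists_fixesLine_of_nilpotent
        (p := y.1 0 0 - x.1 1 1) (q := y.1 0 1 + x.1 0 1) (r := y.1 1 0 + x.1 1 0) (by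
          by_contra! h0
          obtain ⟨h1, h2, h3⟩ := h0
          apply hyx'
          refine ⟨by linear_combination h1, by linear_combination h2, by linear_combination h3,
            by linear_combination hy - hx - h1⟩) (by
          linear_combination h - dx - dy + (y.1 0 0 - x.1 1 1) * (hy - hx))
      refine hxy u v huv (hfix x ?_) (hfix y ?_)
      · linear_combination h - 2 * dx + x.1 1 1 * (hx - hy)
      · linear_combination h - 2 * dy - y.1 0 0 * (hx - hy)

/-- Put `z = x y`. Since `x⁻¹ = t - x`, the trace of `y = x⁻¹ z` is `t tr z - tr (x z)`, and
likewise for `x'`. So `x' - x` is orthogonal to `z` under the trace form. -/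
theorem trace_fiber {t : F} {x y x' y' : SL(2, F)} (hx : slTrace x = t) (hy : slTrace y = t)
    (hx' : slTrace x' = t) (hy' : slTrace y' = t) (h1 : x' * y' = x * y) :
    (x'.1 0 0 - x.1 0 0) * (x * y).1 0 0 + (x'.1 0 1 - x.1 0 1) * (x * y).1 1 0 +
      (x'.1 1 0 - x.1 1 0) * (x * y).1 0 1 + (x'.1 1 1 - x.1 1 1) * (x * y).1 1 1 = 0 := by
  obtain rfl : y' = x'⁻¹ * (x * y) := by rw [← h1]; group
  obtain ⟨z, rfl⟩ : ∃ z, y = x⁻¹ * z := ⟨x * y, by group⟩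
  rw [mul_inv_cancel_left] at *
  simp only [slTrace, sl2_mul, sl2_inv] at *
  linear_combination hy - hy' + z.1 0 0 * (hx' - hx) + z.1 1 1 * (hx' - hx)

/-- For `d = x' - x`, the traces of `d`, `d x y` and `d x w` vanish: three independent linear
conditions on `d x`. A fibre thus lies on a line `x + s d`, and `det = 1` is quadratic in `s`. A
third point makes the quadratic vanish identically, so `d` is nilpotent and its line is fixed by `x`
and by `x y`, hence by `y`. -/
theorem fiber_eq {t : F} (ht : t ≠ 0) {x y w x' y' w' x'' y'' w'' : SL(2, F)}
    (hx : slTrace x = t) (hy : slTrace y = t) (hw : slTrace w = t)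
    (hx' : slTrace x' = t) (hy' : slTrace y' = t) (hw' : slTrace w' = t)
    (hx'' : slTrace x'' = t) (hy'' : slTrace y'' = t) (hw'' : slTrace w'' = t)
    (hxy : NoCommonLine x y) (hyx : y ≠ x⁻¹) (hwx : w ≠ x⁻¹) (hwy : w ≠ y)
    (h1 : x' * y' = x * y) (h2 : x' * w' = x * w) (h3 : x'' * y'' = x * y)
    (h4 : x'' * w'' = x * w) (n1 : x' ≠ x) (n2 : x'' ≠ x) (n3 : x' ≠ x'') : False := by
  have hLI := linearIndependent_of_noCommonLine ht hx hy hw hxy hyx hwx hwy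
  have dx := sl2_det x
  have dx' := sl2_det x'
  have dx'' := sl2_det x''
  have sys : ∀ z y' w' : SL(2, F), slTrace z = t → slTrace y' = t → slTrace w' = t →
      z * y' = x * y → z * w' = x * w →
      -- The unknown is `(z - x) x`, listed by columns so that each row computes a trace.
      (Matrix.of ![![w.1 0 0, w.1 0 1, w.1 1 0, w.1 1 1],
        ![x.1 1 1, -x.1 0 1, -x.1 1 0, x.1 0 0],
        ![y.1 0 0, y.1 0 1, y.1 1 0, y.1 1 1]]).mulVec
      ![(z.1 0 0 - x.1 0 0) * x.1 0 0 + (z.1 0 1 - x.1 0 1) * x.1 1 0,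
        (z.1 1 0 - x.1 1 0) * x.1 0 0 + (z.1 1 1 - x.1 1 1) * x.1 1 0,
        (z.1 0 0 - x.1 0 0) * x.1 0 1 + (z.1 0 1 - x.1 0 1) * x.1 1 1,
        (z.1 1 0 - x.1 1 0) * x.1 0 1 + (z.1 1 1 - x.1 1 1) * x.1 1 1] = 0 := by
    intro z y' w' hz hy' hw' e1 e2
    have f1 := trace_fiber hx hy hz hy' e1
    have f2 := trace_fiber hx hw hz hw' e2
    simp only [sl2_mul] at f1 f2
    have hzx : z.1 0 0 + z.1 1 1 = x.1 0 0 + x.1 1 1 := hz.trans hx.symm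
    ext i
    fin_cases i <;> simp [Matrix.mulVec, dotProduct, Fin.sum_univ_four]
    · linear_combination f2
    · linear_combination (x.1 0 0 * x.1 1 1 - x.1 0 1 * x.1 1 0) * hzx
    · linear_combination f1
  have s1 := sys x' y' w' hx' hy' hw' h1 h2
  have s2 := sys x'' y'' w'' hx'' hy'' hw'' h3 h4
  have f1 := trace_fiber hx hy hx' hy' h1
  have t1 : x'.1 0 0 + x'.1 1 1 = x.1 0 0 + x.1 1 1 := hx'.trans hx.symm
  have key : ∀ z : SL(2, F), ∀ s : F,
      ![(z.1 0 0 - x.1 0 0) * x.1 0 0 + (z.1 0 1 - x.1 0 1) * x.1 1 0,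
        (z.1 1 0 - x.1 1 0) * x.1 0 0 + (z.1 1 1 - x.1 1 1) * x.1 1 0,
        (z.1 0 0 - x.1 0 0) * x.1 0 1 + (z.1 0 1 - x.1 0 1) * x.1 1 1,
        (z.1 1 0 - x.1 1 0) * x.1 0 1 + (z.1 1 1 - x.1 1 1) * x.1 1 1] = s •
      ![(x'.1 0 0 - x.1 0 0) * x.1 0 0 + (x'.1 0 1 - x.1 0 1) * x.1 1 0,
        (x'.1 1 0 - x.1 1 0) * x.1 0 0 + (x'.1 1 1 - x.1 1 1) * x.1 1 0,
        (x'.1 0 0 - x.1 0 0) * x.1 0 1 + (x'.1 0 1 - x.1 0 1) * x.1 1 1,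
        (x'.1 1 0 - x.1 1 0) * x.1 0 1 + (x'.1 1 1 - x.1 1 1) * x.1 1 1] →
      z.1 0 0 - x.1 0 0 = s * (x'.1 0 0 - x.1 0 0) ∧ z.1 0 1 - x.1 0 1 = s * (x'.1 0 1 - x.1 0 1) ∧
      z.1 1 0 - x.1 1 0 = s * (x'.1 1 0 - x.1 1 0) ∧
      z.1 1 1 - x.1 1 1 = s * (x'.1 1 1 - x.1 1 1) := by
    intro z s h
    have g0 := congrFun h 0
    have g1 := congrFun h 1
    have g2 := congrFun h 2
    have g3 := congrFun h 3
    simp at g0 g1 g2 g3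
    generalize x'.1 0 0 - x.1 0 0 = a at *
    generalize x'.1 0 1 - x.1 0 1 = b at *
    generalize x'.1 1 0 - x.1 1 0 = c at *
    generalize x'.1 1 1 - x.1 1 1 = d at *
    generalize z.1 0 0 - x.1 0 0 = a' at *
    generalize z.1 0 1 - x.1 0 1 = b' at *
    generalize z.1 1 0 - x.1 1 0 = c' at *
    generalize z.1 1 1 - x.1 1 1 = d' at *
    refine ⟨?_, ?_, ?_, ?_⟩
    · linear_combination x.1 1 1 * g0 - x.1 1 0 * g2 - (a' - s * a) * dx
    · linear_combination x.1 0 0 * g2 - x.1 0 1 * g0 - (b' - s * b) * dx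
    · linear_combination x.1 1 1 * g1 - x.1 1 0 * g3 - (c' - s * c) * dx
    · linear_combination x.1 0 0 * g3 - x.1 0 1 * g1 - (d' - s * d) * dx
  have hne : x'.1 0 0 - x.1 0 0 ≠ 0 ∨ x'.1 0 1 - x.1 0 1 ≠ 0 ∨ x'.1 1 0 - x.1 1 0 ≠ 0 := by
    by_contra! h0
    obtain ⟨h5, h6, h7⟩ := h0
    exact n1 (sl2_ext (sub_eq_zero.1 h5) (sub_eq_zero.1 h6) (sub_eq_zero.1 h7)
      (by linear_combination t1 - h5))
  have hD0 : ![(x'.1 0 0 - x.1 0 0) * x.1 0 0 + (x'.1 0 1 - x.1 0 1) * x.1 1 0,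
        (x'.1 1 0 - x.1 1 0) * x.1 0 0 + (x'.1 1 1 - x.1 1 1) * x.1 1 0,
        (x'.1 0 0 - x.1 0 0) * x.1 0 1 + (x'.1 0 1 - x.1 0 1) * x.1 1 1,
        (x'.1 1 0 - x.1 1 0) * x.1 0 1 + (x'.1 1 1 - x.1 1 1) * x.1 1 1] ≠ 0 := by
    intro h0
    obtain ⟨k0, k1, k2, k3⟩ := key x' 0 (by rw [h0]; simp)
    simp only [zero_mul] at k0 k1 k2
    rcases hne with h | h | h
    · exact h k0
    · exact h k1
    · exact h k2
  obtain ⟨s, hs⟩ := solutions_proportional hLI s1 s2 hD0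
  obtain ⟨k0, k1, k2, k3⟩ := key x'' s hs
  have hs0 : s ≠ 0 := by
    rintro rfl
    simp only [zero_mul, sub_eq_zero] at k0 k1 k2 k3
    exact n2 (sl2_ext k0 k1 k2 k3)
  have hs1 : s - 1 ≠ 0 := by
    intro h
    obtain rfl : s = 1 := by linear_combination h
    apply n3
    apply sl2_ext
    · linear_combination -k0
    · linear_combination -k1
    · linear_combination -k2
    · linear_combination -k3
  obtain ⟨a, ha⟩ : ∃ a, a = x'.1 0 0 - x.1 0 0 := ⟨_, rfl⟩
  obtain ⟨b, hb⟩ : ∃ b, b = x'.1 0 1 - x.1 0 1 := ⟨_, rfl⟩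
  obtain ⟨c, hc⟩ : ∃ c, c = x'.1 1 0 - x.1 1 0 := ⟨_, rfl⟩
  have hd : x'.1 1 1 - x.1 1 1 = -a := by rw [ha]; linear_combination t1
  rw [hd] at f1 k3
  rw [← ha] at f1 k0 hne
  rw [← hb] at f1 k1 hne
  rw [← hc] at f1 k2 hne
  -- `det (x + s d) = 1` at `s = 1`, then at the second value of `s` after division by `s`;
  -- subtracting isolates `det d`.
  have q1 : -(a ^ 2 + b * c) + (a * x.1 1 1 - a * x.1 0 0 - b * x.1 1 0 - c * x.1 0 1) = 0 := by
    rw [show x'.1 0 0 = x.1 0 0 + a by rw [ha]; ring, show x'.1 0 1 = x.1 0 1 + b by rw [hb]; ring,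
      show x'.1 1 0 = x.1 1 0 + c by rw [hc]; ring,
      show x'.1 1 1 = x.1 1 1 - a by linear_combination hd] at dx'
    linear_combination dx' - dx
  have q2 : -(s * (a ^ 2 + b * c)) + (a * x.1 1 1 - a * x.1 0 0 - b * x.1 1 0 - c * x.1 0 1) = 0 := by
    rw [show x''.1 0 0 = x.1 0 0 + s * a by linear_combination k0,
      show x''.1 0 1 = x.1 0 1 + s * b by linear_combination k1,
      show x''.1 1 0 = x.1 1 0 + s * c by linear_combination k2,
      show x''.1 1 1 = x.1 1 1 - s * a by linear_combination k3] at dx''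
    apply mul_left_cancel₀ hs0
    linear_combination dx'' - dx
  have hnil : a ^ 2 + b * c = 0 := by
    apply mul_left_cancel₀ hs1
    linear_combination q1 - q2
  obtain ⟨u, v, huv, hfix⟩ := exists_fixesLine_of_nilpotent hne hnil
  have F1 := hfix x (by linear_combination hnil - q1 - 2 * hnil)
  have F2 := hfix (x * y) (by linear_combination f1)
  exact hxy u v huv F1 (F1.of_mul huv F2)

end LarsenPink

/-! ### Counting triples: the Larsen–Pink inequality -/

theorem card_mul_le_card_filter_product {α β : Type*} [DecidableEq α] [DecidableEq β]
    (s : Finset α) (t : Finset β) (P : α → β → Prop) [∀ a b, Decidable (P a b)] (m : ℕ)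
    (h : ∀ a ∈ s, m ≤ (t.filter (P a)).card) :
    s.card * m ≤ ((s ×ˢ t).filter fun x => P x.1 x.2).card := by
  simp only [Finset.card_filter, Finset.sum_product]
  simp only [Finset.card_filter] at h
  simpa using Finset.card_nsmul_le_sum s _ m h

theorem card_sub_le_card_filter {α : Type*} [DecidableEq α] (t b : Finset α) (P : α → Prop)
    [DecidablePred P] (h : ∀ a ∈ t, a ∉ b → P a) : t.card - b.card ≤ (t.filter P).card := by
  refine (Finset.le_card_sdiff b t).trans (Finset.card_le_card ?_)
  intro a ha
  rw [Finset.mem_sdiff] at ha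
  exact Finset.mem_filter.2 ⟨ha.1, h a ha.1 ha.2⟩

section LarsenPink

variable {F : Type*} [Field F]

/-- No line of `F²` is fixed by all of `S`. -/
def Irred (S : Finset SL(2, F)) : Prop :=
  ∀ u v : F, (u ≠ 0 ∨ v ≠ 0) → ∃ h ∈ S, ¬ FixesLine h u v

variable [DecidableEq F]

/-- The elements of `S` of trace `t`. -/
def tracePart (S : Finset SL(2, F)) (t : F) : Finset SL(2, F) := S.filter fun g => slTrace g = t

/-- Triples in general position in the class inject two-to-one into `S ^ 2 × S ^ 2` by `fiber_eq`.
Given `x`, the bad `y` lie on its two eigenlines (at most `W` each) or equal `x⁻¹`; the bad `w` are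
`x⁻¹` and `y`. -/
theorem tracePart_mul_le {S : Finset SL(2, F)} {t : F} (ht0 : t ≠ 0) (ht : t ^ 2 ≠ 4) {W : ℕ}
    (hW : ∀ u v : F, (u ≠ 0 ∨ v ≠ 0) → ∀ s : Finset SL(2, F),
      (∀ g ∈ s, g ∈ S ∧ FixesLine g u v ∧ slTrace g = t) → s.card ≤ W) :
    (tracePart S t).card * ((tracePart S t).card - (2 * W + 1)) * ((tracePart S t).card - 2)
      ≤ 2 * ((S ^ 2).card * (S ^ 2).card) := by
  classical
  set X := tracePart S t with hX
  have hXm : ∀ g, g ∈ X ↔ g ∈ S ∧ slTrace g = t := fun g => by simp [hX, tracePart]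
  set T := (X ×ˢ X).filter fun x => NoCommonLine x.1 x.2 ∧ x.2 ≠ x.1⁻¹ with hT
  have hTcard : X.card * (X.card - (2 * W + 1)) ≤ T.card := by
    refine card_mul_le_card_filter_product X X (fun x y => NoCommonLine x y ∧ y ≠ x⁻¹) _ ?_
    intro x hx
    obtain ⟨u, v, u', v', h0, h0', hl⟩ := exists_two_lines (x := x) (by rwa [((hXm x).1 hx).2])
    have c1 : (X.filter fun g => FixesLine g u v).card ≤ W := hW u v h0 _ fun g hg => by
      rw [Finset.mem_filter, hXm] at hg
      exact ⟨hg.1.1, hg.2, hg.1.2⟩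
    have c2 : (X.filter fun g => FixesLine g u' v').card ≤ W := hW u' v' h0' _ fun g hg => by
      rw [Finset.mem_filter, hXm] at hg
      exact ⟨hg.1.1, hg.2, hg.1.2⟩
    set b := ((X.filter fun g => FixesLine g u v) ∪ (X.filter fun g => FixesLine g u' v')) ∪ {x⁻¹}
      with hb
    have hbc : b.card ≤ 2 * W + 1 := by
      refine (Finset.card_union_le _ _).trans ?_
      have := Finset.card_union_le (X.filter fun g => FixesLine g u v)
        (X.filter fun g => FixesLine g u' v')
      rw [Finset.card_singleton]
      omega
    refine le_trans (by omega) (card_sub_le_card_filter X b _ ?_)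
    intro y hy hyb
    simp only [hb, Finset.mem_union, Finset.mem_filter, Finset.mem_singleton, not_or, not_and]
      at hyb
    refine ⟨fun p q hpq hxp hyp => ?_, hyb.2⟩
    rcases hl p q hpq hxp y hyp with h | h
    · exact hyb.1.1 hy h
    · exact hyb.1.2 hy h
  set Q := (T ×ˢ X).filter fun x => x.2 ≠ x.1.1⁻¹ ∧ x.2 ≠ x.1.2 with hQ
  have hQcard : T.card * (X.card - 2) ≤ Q.card := by
    refine card_mul_le_card_filter_product T X (fun x w => w ≠ x.1⁻¹ ∧ w ≠ x.2) _ ?_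
    intro x _
    have hbc : ({x.1⁻¹, x.2} : Finset SL(2, F)).card ≤ 2 := Finset.card_le_two
    refine le_trans (by omega) (card_sub_le_card_filter X {x.1⁻¹, x.2} _ ?_)
    intro w _ hw
    simpa using hw
  refine (Nat.mul_le_mul_right _ hTcard).trans (hQcard.trans ?_)
  refine (Finset.card_le_mul_card_image
    (f := fun x : (SL(2, F) × SL(2, F)) × SL(2, F) => (x.1.1 * x.1.2, x.1.1 * x.2)) Q 2 ?_).trans
    (Nat.mul_le_mul_left _ ?_)
  · rintro ⟨a, b⟩ -
    by_contra! hcard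
    obtain ⟨x, hx, y, hy, z, hz, hxy, hxz, hyz⟩ := Finset.two_lt_card.1 hcard
    obtain ⟨⟨x1, x2⟩, x3⟩ := x
    obtain ⟨⟨y1, y2⟩, y3⟩ := y
    obtain ⟨⟨z1, z2⟩, z3⟩ := z
    simp only [hQ, hT, Finset.mem_filter, Finset.mem_product, hXm, Prod.mk.injEq] at hx hy hz
    obtain ⟨⟨⟨⟨⟨⟨-, hx1⟩, -, hx2⟩, hx4, hx5⟩, -, hx3⟩, hx6, hx7⟩, hxa, hxb⟩ := hx
    obtain ⟨⟨⟨⟨⟨⟨-, hy1⟩, -, hy2⟩, -⟩, -, hy3⟩, -⟩, hya, hyb⟩ := hy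
    obtain ⟨⟨⟨⟨⟨⟨-, hz1⟩, -, hz2⟩, -⟩, -, hz3⟩, -⟩, hza, hzb⟩ := hz
    have e : ∀ p1 p2 p3 q1 q2 q3 : SL(2, F), p1 * p2 = a → p1 * p3 = b → q1 * q2 = a →
        q1 * q3 = b → ((p1, p2), p3) ≠ ((q1, q2), q3) → p1 ≠ q1 := by
      rintro p1 p2 p3 q1 q2 q3 h1 h2 h3 h4 hne rfl
      apply hne
      rw [mul_left_cancel (h1.trans h3.symm), mul_left_cancel (h2.trans h4.symm)]
    exact fiber_eq ht0 hx1 hx2 hx3 hy1 hy2 hy3 hz1 hz2 hz3 hx4 hx5 hx6 hx7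
      (hya.trans hxa.symm) (hyb.trans hxb.symm) (hza.trans hxa.symm) (hzb.trans hxb.symm)
      (e _ _ _ _ _ _ hya hyb hxa hxb hxy.symm) (e _ _ _ _ _ _ hza hzb hxa hxb hxz.symm)
      (e _ _ _ _ _ _ hya hyb hza hzb hyz)
  · rw [← Finset.card_product]
    refine Finset.card_le_card ?_
    intro x hx
    rw [Finset.mem_image] at hx
    obtain ⟨⟨⟨x1, x2⟩, x3⟩, hx, rfl⟩ := hx
    simp only [hQ, hT, Finset.mem_filter, Finset.mem_product, hXm] at hx
    obtain ⟨⟨⟨⟨⟨hx1, -⟩, hx2, -⟩, -⟩, hx3, -⟩, -⟩ := hx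
    rw [Finset.mem_product, pow_two]
    exact ⟨Finset.mul_mem_mul hx1 hx2, Finset.mul_mem_mul hx1 hx3⟩

/-- A Larsen–Pink inequality for regular semisimple classes of nonzero trace. -/
theorem larsen_pink {S : Finset SL(2, F)} (hS : S⁻¹ = S) (h1 : 1 ∈ S) (hirr : Irred S) {t : F}
    (ht0 : t ≠ 0) (ht : t ^ 2 ≠ 4) :
    (tracePart S t).card ^ 3 ≤ 11664 * (S ^ 8).card ^ 2 := by
  set N := (S ^ 8).card with hN
  have hN1 : 1 ≤ N := Finset.card_pos.2 (Finset.Nonempty.pow ⟨1, h1⟩)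
  -- The integer cube root of `16 N`, the largest size allowed by `card_fixesLine_trace_le`.
  set W := Nat.findGreatest (fun w => w ^ 3 ≤ 16 * N) (16 * N) with hWdef
  have hW3 : W ^ 3 ≤ 16 * N :=
    Nat.findGreatest_spec (P := fun w => w ^ 3 ≤ 16 * N) (m := 0) (by omega) (by simp)
  have hWle : ∀ w : ℕ, w ^ 3 ≤ 16 * N → w ≤ W := fun w hw =>
    Nat.le_findGreatest ((Nat.le_self_pow (by norm_num) w).trans hw) hw
  have hW1 : 1 ≤ W := hWle 1 (by omega)
  have key := tracePart_mul_le (S := S) ht0 ht (W := W) (by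
    intro u v h0 s hs
    obtain ⟨h, hh, hf⟩ := hirr u v h0
    exact hWle _ (card_fixesLine_trace_le hS h0 hh hf t s hs))
  have h2 : (S ^ 2).card ≤ N := Finset.card_le_card (Finset.pow_subset_pow_right h1 (by norm_num))
  generalize (tracePart S t).card = x at key
  -- Above `9 W` the excluded elements are a minor part and `x³` is at most a constant times `N²`;
  -- below, `x³ ≤ 729 · 16 N = 11664 N`.
  rcases le_or_gt x (9 * W) with hx | hx
  · calc x ^ 3 ≤ (9 * W) ^ 3 := Nat.pow_le_pow_left hx 3
      _ = 729 * W ^ 3 := by ring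
      _ ≤ 729 * (16 * N) := Nat.mul_le_mul_left _ hW3
      _ ≤ 11664 * N ^ 2 := by nlinarith
  · obtain ⟨y, hy⟩ : ∃ y, y = x / 3 := ⟨_, rfl⟩
    have a1 : y ≤ x - (2 * W + 1) := by omega
    have a2 : y ≤ x - 2 := by omega
    have a3 : x ≤ 4 * y := by omega
    have : x * y * y ≤ 2 * (N * N) := by
      calc x * y * y ≤ x * (x - (2 * W + 1)) * (x - 2) := by gcongr
        _ ≤ _ := key
        _ ≤ _ := by gcongr
    calc x ^ 3 = x * x * x := by ring
      _ ≤ x * (4 * y) * (4 * y) := by gcongr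
      _ = 16 * (x * y * y) := by ring
      _ ≤ 16 * (2 * (N * N)) := by gcongr
      _ ≤ 11664 * N ^ 2 := by nlinarith

end LarsenPink

/-! ### Tori, the pivot argument and the growth dichotomy -/

section Centralizer

variable {F : Type*} [Field F]

/-- The centralizer of a non-scalar matrix consists of its linear polynomials. -/
theorem eq_linear_of_commute {g k : SL(2, F)} (hg : slTrace g ^ 2 ≠ 4) (hk : k * g = g * k) :
    ∃ a b : F, k.1 0 0 = a + b * g.1 0 0 ∧ k.1 0 1 = b * g.1 0 1 ∧ k.1 1 0 = b * g.1 1 0 ∧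
      k.1 1 1 = a + b * g.1 1 1 := by
  have dg := sl2_det g
  have q00 := congrArg (fun g : SL(2, F) => g.1 0 0) hk
  have q01 := congrArg (fun g : SL(2, F) => g.1 0 1) hk
  have q10 := congrArg (fun g : SL(2, F) => g.1 1 0) hk
  simp only [sl2_mul] at q00 q01 q10
  by_cases hb : g.1 0 1 = 0
  · by_cases hc : g.1 1 0 = 0
    · have hne : g.1 0 0 - g.1 1 1 ≠ 0 := by
        intro h
        apply hg
        rw [hb] at dg
        unfold slTrace
        linear_combination (g.1 0 0 - g.1 1 1) * h + 4 * dg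
      have h01 : k.1 0 1 = 0 := by
        apply mul_left_cancel₀ hne
        rw [hb] at q01
        linear_combination -q01
      have h10 : k.1 1 0 = 0 := by
        apply mul_left_cancel₀ hne
        rw [hc] at q10
        linear_combination q10
      refine ⟨k.1 0 0 - (k.1 0 0 - k.1 1 1) / (g.1 0 0 - g.1 1 1) * g.1 0 0,
        (k.1 0 0 - k.1 1 1) / (g.1 0 0 - g.1 1 1), by ring, by rw [h01, hb]; ring, by rw [h10, hc]; ring, ?_⟩
      field_simp
      ring
    · refine ⟨k.1 0 0 - k.1 1 0 / g.1 1 0 * g.1 0 0, k.1 1 0 / g.1 1 0, by ring, ?_,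
        by field_simp, ?_⟩
      · field_simp
        linear_combination q00
      · field_simp
        linear_combination q10
  · refine ⟨k.1 0 0 - k.1 0 1 / g.1 0 1 * g.1 0 0, k.1 0 1 / g.1 0 1, by ring, by field_simp, ?_, ?_⟩
    · field_simp
      linear_combination -q00
    · field_simp
      linear_combination -q01

/-- Write `k = a + b g`. If `b = 0` then `k` is scalar of determinant 1 and has squared trace 4; so
`b ≠ 0` and `g` is a polynomial in `k`. -/
theorem commute_of_commute_regular {g k j : SL(2, F)} (hg : slTrace g ^ 2 ≠ 4)
    (hk : slTrace k ^ 2 ≠ 4) (hkg : k * g = g * k) (hj : j * k = k * j) : j * g = g * j := by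
  obtain ⟨a, b, h00, h01, h10, h11⟩ := eq_linear_of_commute hg hkg
  have hb : b ≠ 0 := by
    rintro rfl
    apply hk
    have dk := sl2_det k
    rw [h00, h01, h10, h11] at dk
    unfold slTrace
    rw [h00, h11]
    linear_combination 4 * dk
  have q00 := congrArg (fun g : SL(2, F) => g.1 0 0) hj
  have q01 := congrArg (fun g : SL(2, F) => g.1 0 1) hj
  have q10 := congrArg (fun g : SL(2, F) => g.1 1 0) hj
  have q11 := congrArg (fun g : SL(2, F) => g.1 1 1) hj
  simp only [sl2_mul, h00, h01, h10, h11] at q00 q01 q10 q11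
  apply sl2_ext <;> simp only [sl2_mul] <;> apply mul_left_cancel₀ hb
  · linear_combination q00
  · linear_combination q01
  · linear_combination q10
  · linear_combination q11

/-- Such elements satisfy `2 k = s + b (2 g - tr g)`, and the determinant fixes `b²`. -/
theorem card_commute_trace_le (h2 : (2 : F) ≠ 0) {g : SL(2, F)} (hg : slTrace g ^ 2 ≠ 4) (s : F)
    (A : Finset SL(2, F)) (hA : ∀ k ∈ A, k * g = g * k ∧ slTrace k = s) : A.card ≤ 2 := by
  by_contra! hcard
  obtain ⟨k, hk, l, hl, m, hm, hkl, hkm, hlm⟩ := Finset.two_lt_card.1 hcard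
  have dg := sl2_det g
  have key : ∀ k ∈ A, ∃ b : F, 2 * k.1 0 0 = s + b * (g.1 0 0 - g.1 1 1) ∧ k.1 0 1 = b * g.1 0 1 ∧
      k.1 1 0 = b * g.1 1 0 ∧ 2 * k.1 1 1 = s - b * (g.1 0 0 - g.1 1 1) ∧
      b ^ 2 * (slTrace g ^ 2 - 4) = s ^ 2 - 4 := by
    intro k hk
    obtain ⟨hk, hs⟩ := hA k hk
    obtain ⟨a, b, h00, h01, h10, h11⟩ := eq_linear_of_commute hg hk
    have dk := sl2_det k
    unfold slTrace at *
    rw [h00, h01, h10, h11] at dk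
    refine ⟨b, by linear_combination h00 - h11 + hs, h01, h10,
      by linear_combination h11 - h00 + hs, ?_⟩
    rw [← hs, h00, h11]
    linear_combination 4 * b ^ 2 * dg - 4 * dk
  have hne : slTrace g ^ 2 - 4 ≠ 0 := sub_ne_zero.2 hg
  have inj : ∀ k ∈ A, ∀ l ∈ A, ∀ b c : F, b = c →
      (2 * k.1 0 0 = s + b * (g.1 0 0 - g.1 1 1) ∧ k.1 0 1 = b * g.1 0 1 ∧
      k.1 1 0 = b * g.1 1 0 ∧ 2 * k.1 1 1 = s - b * (g.1 0 0 - g.1 1 1) ∧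
      b ^ 2 * (slTrace g ^ 2 - 4) = s ^ 2 - 4) →
      (2 * l.1 0 0 = s + c * (g.1 0 0 - g.1 1 1) ∧ l.1 0 1 = c * g.1 0 1 ∧
      l.1 1 0 = c * g.1 1 0 ∧ 2 * l.1 1 1 = s - c * (g.1 0 0 - g.1 1 1) ∧
      c ^ 2 * (slTrace g ^ 2 - 4) = s ^ 2 - 4) → k = l := by
    rintro k - l - b c rfl ⟨e1, e2, e3, e4, -⟩ ⟨f1, f2, f3, f4, -⟩
    exact sl2_ext (mul_left_cancel₀ h2 (e1.trans f1.symm)) (e2.trans f2.symm) (e3.trans f3.symm)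
      (mul_left_cancel₀ h2 (e4.trans f4.symm))
  obtain ⟨b, hb⟩ := key k hk
  obtain ⟨c, hc⟩ := key l hl
  obtain ⟨d, hd⟩ := key m hm
  have neg : ∀ b c : F, b ≠ c → b ^ 2 * (slTrace g ^ 2 - 4) = s ^ 2 - 4 →
      c ^ 2 * (slTrace g ^ 2 - 4) = s ^ 2 - 4 → b + c = 0 := by
    intro b c hbc e1 e2
    apply mul_left_cancel₀ hne
    apply mul_left_cancel₀ (sub_ne_zero.2 hbc)
    linear_combination e1 - e2
  have hbc := neg b c (fun h => hkl (inj k hk l hl b c h hb hc)) hb.2.2.2.2 hc.2.2.2.2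
  have hbd := neg b d (fun h => hkm (inj k hk m hm b d h hb hd)) hb.2.2.2.2 hd.2.2.2.2
  exact hlm (inj l hl m hm c d (by linear_combination hbc - hbd) hc hd)

variable [DecidableEq F]

/-- The elements of `S` that commute with `g`. -/
def centPart (S : Finset SL(2, F)) (g : SL(2, F)) : Finset SL(2, F) :=
  S.filter fun h => h * g = g * h

/-- Orbit-stabilizer for the conjugation action of a finite set. -/
theorem card_le_cent_mul_trace {H : Finset SL(2, F)} (hH : H⁻¹ = H) {m : ℕ} {g : SL(2, F)}
    (hg : g ∈ H ^ m) :
    H.card ≤ (centPart (H ^ 2) g).card * (tracePart (H ^ (m + 2)) (slTrace g)).card := by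
  refine (Finset.card_le_mul_card_image (f := fun h => h * g * h⁻¹) _
    (centPart (H ^ 2) g).card ?_).trans (Nat.mul_le_mul_left _ (Finset.card_le_card ?_))
  · intro l hl
    obtain ⟨x, hx, rfl⟩ := Finset.mem_image.1 hl
    refine Finset.card_le_card_of_injOn (fun h => x⁻¹ * h) ?_ (mul_right_injective _).injOn
    intro h hh
    simp only [Finset.coe_filter, Set.mem_ofPred_eq] at hh
    simp only [centPart, Finset.coe_filter, Set.mem_ofPred_eq]
    refine ⟨inv_mul_mem_sq hH hx hh.1, ?_⟩
    have := hh.2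
    rw [mul_inv_eq_iff_eq_mul] at this
    rw [mul_assoc, this]; group
  · intro l hl
    obtain ⟨x, hx, rfl⟩ := Finset.mem_image.1 hl
    refine Finset.mem_filter.2 ⟨?_, slTrace_conj x g⟩
    have hx1 : x ∈ H ^ 1 := by simpa using hx
    have := mul_mem_finset_pow (mul_mem_finset_pow hx1 hg) (inv_mem_finset_pow hH hx1)
    rwa [show 1 + m + 1 = m + 2 by ring] at this

/-- Each of the traces 0, 2 and -2 is taken at most twice on the torus, so seven elements suffice.
-/
theorem exists_regular (h2 : (2 : F) ≠ 0) {S : Finset SL(2, F)} {g : SL(2, F)}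
    (hg : slTrace g ^ 2 ≠ 4) (hc : 7 ≤ (centPart S g).card) :
    ∃ k ∈ S, k * g = g * k ∧ slTrace k ≠ 0 ∧ slTrace k ^ 2 ≠ 4 := by
  by_contra! hcon
  have hsub : centPart S g ⊆ (tracePart (centPart S g) 0 ∪ tracePart (centPart S g) 2) ∪
      tracePart (centPart S g) (-2) := by
    intro k hk
    have hk' := Finset.mem_filter.1 hk
    simp only [Finset.mem_union, tracePart, Finset.mem_filter]
    by_cases h0 : slTrace k = 0
    · simp [hk, h0]
    · have := hcon k hk'.1 hk'.2 h0
      have h3 : (slTrace k - 2) * (slTrace k + 2) = 0 := by linear_combination this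
      rcases mul_eq_zero.1 h3 with h | h
      · simp [hk, sub_eq_zero.1 h]
      · simp [hk, eq_neg_of_add_eq_zero_left h]
  have hle : ∀ s, (tracePart (centPart S g) s).card ≤ 2 := fun s =>
    card_commute_trace_le h2 hg s _ fun k hk => by
      simp only [tracePart, centPart, Finset.mem_filter] at hk
      exact ⟨hk.1.2, hk.2⟩
  have := (Finset.card_le_card hsub).trans (Finset.card_union_le _ _)
  have := Finset.card_union_le (tracePart (centPart S g) 0) (tracePart (centPart S g) 2)
  have := hle 0
  have := hle 2
  have := hle (-2)
  omega

/-- The pivot. A rich torus contains a regular `k` in `H ^ 2` of nonzero trace. For a generator `a`,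
the element `a k a⁻¹` lies in `H ^ 4`, so its torus is rich, and this is the torus conjugated by
`a`. Induction along words reaches every conjugate. -/
theorem cent_conj_of_generates (h2 : (2 : F) ≠ 0) {H : Finset SL(2, F)} (hH : H⁻¹ = H)
    (h1 : 1 ∈ H) (hgen : Subgroup.closure (H : Set SL(2, F)) = ⊤) {L : ℕ} (hL : 7 ≤ L)
    (hLc : ∀ g ∈ H ^ 10, slTrace g ≠ 0 → slTrace g ^ 2 ≠ 4 → L ≤ (centPart (H ^ 2) g).card)
    {g : SL(2, F)} (hg : g ∈ H ^ 10) (hg0 : slTrace g ≠ 0) (hg4 : slTrace g ^ 2 ≠ 4)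
    (x : SL(2, F)) : L ≤ (centPart (H ^ 2) (x * g * x⁻¹)).card := by
  have step : ∀ a ∈ H, ∀ y, L ≤ (centPart (H ^ 2) (y * g * y⁻¹)).card →
      L ≤ (centPart (H ^ 2) (a * y * g * (a * y)⁻¹)).card := by
    intro a ha y hy
    obtain ⟨k, hk, hkg, hk0, hk4⟩ := exists_regular h2 (S := H ^ 2) (g := y * g * y⁻¹)
      (by rwa [slTrace_conj]) (hL.trans hy)
    have ha1 : a ∈ H ^ 1 := by simpa using ha
    have hmem := mul_mem_finset_pow (mul_mem_finset_pow ha1 hk) (inv_mem_finset_pow hH ha1)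
    refine (hLc (a * k * a⁻¹) (Finset.pow_subset_pow_right h1 (by norm_num) hmem)
      (by rwa [slTrace_conj]) (by rwa [slTrace_conj])).trans (Finset.card_le_card ?_)
    intro j hj
    rw [centPart, Finset.mem_filter] at hj ⊢
    refine ⟨hj.1, commute_of_commute_regular (k := a * k * a⁻¹) (by rwa [slTrace_conj])
      (by rwa [slTrace_conj]) ?_ hj.2⟩
    calc a * k * a⁻¹ * (a * y * g * (a * y)⁻¹) = a * (k * (y * g * y⁻¹)) * a⁻¹ := by group
      _ = a * ((y * g * y⁻¹) * k) * a⁻¹ := by rw [hkg]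
      _ = _ := by group
  have hx : x ∈ Subgroup.closure (H : Set SL(2, F)) := by rw [hgen]; trivial
  induction hx using Subgroup.closure_induction_left with
  | one => simpa using hLc g hg hg0 hg4
  | mul_left a ha y _ ih => exact step a ha y ih
  | inv_mul_cancel a ha y _ ih =>
    refine step a⁻¹ ?_ y ih
    rw [← hH]; exact Finset.inv_mem_inv ha

variable [Fintype F]

theorem card_commute_le (h2 : (2 : F) ≠ 0) {g : SL(2, F)} (hg : slTrace g ^ 2 ≠ 4) :
    (centPart Finset.univ g).card ≤ 2 * Fintype.card F := by
  refine (Finset.card_le_mul_card_image (f := slTrace) _ 2 ?_).trans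
    (Nat.mul_le_mul_left _ (Finset.card_le_univ _))
  intro s _
  refine card_commute_trace_le h2 hg s _ fun k hk => ?_
  simp only [centPart, Finset.mem_filter] at hk
  exact ⟨hk.1.2, hk.2⟩

/-- Double count pairs `(x, h)` with `h ∈ P` regular and commuting with `x g x⁻¹`. Each `x` sees at
least `L - 4` such `h`, since at most four have trace ±2. For fixed `h`, the conjugate `x⁻¹ h x` has
at most two values, each on a coset of a centralizer of size at most `2 q`. -/
theorem card_group_mul_le (h2 : (2 : F) ≠ 0) {g : SL(2, F)} (hg : slTrace g ^ 2 ≠ 4)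
    {P : Finset SL(2, F)} {L : ℕ} (hL : ∀ x, L ≤ (centPart P (x * g * x⁻¹)).card) :
    Fintype.card SL(2, F) * (L - 4) ≤ P.card * (4 * Fintype.card F) := by
  classical
  refine le_trans ?_ (Nat.mul_le_mul_right _
    (Finset.card_filter_le P fun h => slTrace h ^ 2 ≠ 4))
  refine Finset.card_mul_le_card_mul (s := Finset.univ)
    (fun (x h : SL(2, F)) => h * (x * g * x⁻¹) = (x * g * x⁻¹) * h) ?_ ?_
  · intro x _
    set g' := x * g * x⁻¹
    have hg' : slTrace g' ^ 2 ≠ 4 := by rwa [slTrace_conj]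
    have hle : ∀ s, (tracePart (centPart P g') s).card ≤ 2 := fun s =>
      card_commute_trace_le h2 hg' s _ fun k hk => by
        simp only [tracePart, centPart, Finset.mem_filter] at hk
        exact ⟨hk.1.2, hk.2⟩
    have hun := Finset.card_union_le (tracePart (centPart P g') 2) (tracePart (centPart P g') (-2))
    have e1 := hle 2
    have e2 := hle (-2)
    have e3 : L ≤ (centPart P g').card := hL x
    refine le_trans (b := (centPart P g').card -
      (tracePart (centPart P g') 2 ∪ tracePart (centPart P g') (-2)).card) (by omega) ?_
    refine (card_sub_le_card_filter _ _ (fun h => slTrace h ^ 2 ≠ 4) ?_).trans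
      (Finset.card_le_card ?_)
    · intro k hk hkn h4
      apply hkn
      have h3 : (slTrace k - 2) * (slTrace k + 2) = 0 := by linear_combination h4
      simp only [Finset.mem_union, tracePart, Finset.mem_filter]
      rcases mul_eq_zero.1 h3 with h | h
      · simp [hk, sub_eq_zero.1 h]
      · simp [hk, eq_neg_of_add_eq_zero_left h]
    · intro k hk
      simp only [centPart, Finset.mem_filter] at hk
      simp only [Finset.bipartiteAbove, Finset.mem_filter]
      exact ⟨⟨hk.1.1, hk.2⟩, hk.1.2⟩
  · intro h hh
    have hh4 := (Finset.mem_filter.1 hh).2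
    refine (Finset.card_le_mul_card_image (f := fun x => x⁻¹ * h * x) _ (2 * Fintype.card F)
      ?_).trans (le_trans (Nat.mul_le_mul_left _ (m := 2) ?_)
      (by ring_nf; exact le_rfl))
    · intro l hl
      obtain ⟨y, hy, rfl⟩ := Finset.mem_image.1 hl
      refine le_trans ?_ (card_commute_le h2 hh4)
      refine Finset.card_le_card_of_injOn (fun x => x * y⁻¹) ?_ (mul_left_injective _).injOn
      intro x hx
      simp only [Finset.coe_filter, Set.mem_ofPred_eq] at hx
      simp only [centPart, Finset.coe_filter, Set.mem_ofPred_eq]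
      refine ⟨Finset.mem_univ _, ?_⟩
      have := hx.2
      have e : h * x = x * (y⁻¹ * h * y) := by rw [← this]; group
      rw [← mul_assoc h, e]; group
    · refine card_commute_trace_le h2 hg (slTrace h) _ fun k hk => ?_
      obtain ⟨y, hy, rfl⟩ := Finset.mem_image.1 hk
      simp only [Finset.bipartiteBelow, Finset.mem_filter] at hy
      refine ⟨?_, by simpa using slTrace_conj y⁻¹ h⟩
      calc y⁻¹ * h * y * g = y⁻¹ * (h * (y * g * y⁻¹)) * y := by group
        _ = y⁻¹ * (y * g * y⁻¹ * h) * y := by rw [hy.2]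
        _ = _ := by group

theorem card_cube_le : Fintype.card F ^ 3 ≤ 2 * Fintype.card SL(2, F) := by
  have hq : 2 ≤ Fintype.card F := Fintype.one_lt_card
  have h : Fintype.card ({a : F // a ≠ 0} × F × F) ≤ Fintype.card SL(2, F) := by
    refine Fintype.card_le_of_injective
      (fun x => ⟨!![x.1.1, x.2.1; x.2.2, (1 + x.2.1 * x.2.2) / x.1.1], ?_⟩) ?_
    · have := x.1.2
      rw [Matrix.det_fin_two_of]
      field_simp
      ring
    · rintro ⟨⟨a, ha⟩, b, c⟩ ⟨⟨a', ha'⟩, b', c'⟩ h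
      have h' := congrArg (fun g : SL(2, F) => (g.1 0 0, g.1 0 1, g.1 1 0)) h
      simpa using h'
  rw [Fintype.card_prod, Fintype.card_prod,
    show Fintype.card {a : F // a ≠ 0} = Fintype.card F - 1 by
      rw [Fintype.card_subtype_compl, Fintype.card_subtype_eq]] at h
  generalize Fintype.card F = q at *
  obtain ⟨r, rfl⟩ : ∃ r, q = r + 2 := ⟨q - 2, by omega⟩
  have e : r + 2 - 1 = r + 1 := by omega
  rw [e] at h
  nlinarith

/-- Either the number of elements grows, or the set is large. -/
theorem growth_of_escape (h2 : (2 : F) ≠ 0) {H : Finset SL(2, F)} (hH : H⁻¹ = H)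
    (h1 : 1 ∈ H) (hgen : Subgroup.closure (H : Set SL(2, F)) = ⊤) (hirr : Irred H)
    {g : SL(2, F)} (hg : g ∈ H ^ 10) (hg0 : slTrace g ≠ 0) (hg4 : slTrace g ^ 2 ≠ 4) :
    H.card ^ 3 ≤ 2519424 * (H ^ 96).card ^ 2 ∨
      Fintype.card F ^ 6 * H.card ^ 3 ≤ 161243136 * (H ^ 96).card ^ 5 := by
  set N := (H ^ 96).card with hN
  have hN1 : 1 ≤ N := Finset.card_pos.2 (Finset.Nonempty.pow ⟨1, h1⟩)
  set W := Nat.findGreatest (fun w => w ^ 3 ≤ 11664 * N ^ 2) (11664 * N ^ 2) with hWdef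
  have hW3 : W ^ 3 ≤ 11664 * N ^ 2 :=
    Nat.findGreatest_spec (P := fun w => w ^ 3 ≤ 11664 * N ^ 2) (m := 0) (by omega) (by simp)
  have hWle : ∀ w : ℕ, w ^ 3 ≤ 11664 * N ^ 2 → w ≤ W := fun w hw =>
    Nat.le_findGreatest ((Nat.le_self_pow (by norm_num) w).trans hw) hw
  have htr : ∀ t : F, t ≠ 0 → t ^ 2 ≠ 4 → (tracePart (H ^ 12) t).card ≤ W := by
    intro t ht0 ht4
    apply hWle
    -- Conjugating an element of `H ^ 10` by `H` lands in `H ^ 12`, and the eighth power of that is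
    -- `H ^ 96`.
    have := larsen_pink (S := H ^ 12) (inv_finset_pow hH 12) (Finset.one_mem_pow h1) (by
      intro u v h0
      obtain ⟨h, hh, hf⟩ := hirr u v h0
      exact ⟨h, Finset.subset_pow h1 (by norm_num) hh, hf⟩) ht0 ht4
    rwa [← pow_mul] at this
  have hcent : ∀ g ∈ H ^ 10, slTrace g ≠ 0 → slTrace g ^ 2 ≠ 4 →
      H.card ≤ (centPart (H ^ 2) g).card * W := fun g hg hg0 hg4 =>
    (card_le_cent_mul_trace hH hg).trans (Nat.mul_le_mul_left _ (htr _ hg0 hg4))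
  rcases le_or_gt H.card (6 * W) with hle | hgt
  · left
    calc H.card ^ 3 ≤ (6 * W) ^ 3 := Nat.pow_le_pow_left hle 3
      _ = 216 * W ^ 3 := by ring
      _ ≤ 216 * (11664 * N ^ 2) := Nat.mul_le_mul_left _ hW3
      _ = _ := by ring
  · right
    have hex : ∃ L, H.card ≤ L * W :=
      ⟨_, hcent g hg hg0 hg4⟩
    classical
    -- The least `L` with `|H| ≤ L W` bounds every centralizer in question from below at once, and
    -- `|H| > 6 W` makes it at least 7.
    obtain ⟨L, hLdef⟩ : ∃ L, L = Nat.find hex := ⟨_, rfl⟩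
    have hLW : H.card ≤ L * W := hLdef ▸ Nat.find_spec hex
    have hL7 : 7 ≤ L := by
      by_contra! h
      have : L * W ≤ 6 * W := Nat.mul_le_mul_right _ (by omega)
      omega
    have hall := cent_conj_of_generates h2 hH h1 hgen hL7
      (fun g hg hg0 hg4 => hLdef ▸ Nat.find_min' hex (hcent g hg hg0 hg4)) hg hg0 hg4
    have hmain := card_group_mul_le h2 hg4 hall
    have hH2 : (H ^ 2).card ≤ N := Finset.card_le_card (Finset.pow_subset_pow_right h1 (by norm_num))
    have hq0 : 0 < Fintype.card F := Fintype.card_pos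
    have hcube := card_cube_le (F := F)
    generalize Fintype.card F = q at *
    generalize Fintype.card SL(2, F) = n at *
    have hq2 : q ^ 2 * L ≤ 24 * N := by
      apply Nat.le_of_mul_le_mul_left _ hq0
      calc q * (q ^ 2 * L) = q ^ 3 * L := by ring
        _ ≤ 2 * n * (3 * (L - 4)) := Nat.mul_le_mul hcube (by omega)
        _ = 6 * (n * (L - 4)) := by ring
        _ ≤ 6 * ((H ^ 2).card * (4 * q)) := Nat.mul_le_mul_left _ hmain
        _ ≤ 6 * (N * (4 * q)) := by gcongr
        _ = q * (24 * N) := by ring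
    have hq3 : q ^ 2 * H.card ≤ 24 * N * W := by
      calc q ^ 2 * H.card ≤ q ^ 2 * (L * W) := Nat.mul_le_mul_left _ hLW
        _ = q ^ 2 * L * W := by ring
        _ ≤ _ := Nat.mul_le_mul_right _ hq2
    calc q ^ 6 * H.card ^ 3 = (q ^ 2 * H.card) ^ 3 := by ring
      _ ≤ (24 * N * W) ^ 3 := Nat.pow_le_pow_left hq3 3
      _ = 13824 * N ^ 3 * W ^ 3 := by ring
      _ ≤ 13824 * N ^ 3 * (11664 * N ^ 2) := Nat.mul_le_mul_left _ hW3
      _ = _ := by ring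

end Centralizer

/-! ### Generation by unitriangulars and escape from degenerate traces -/

section Escape

variable {F : Type*} [Field F]

/-- The upper unitriangular matrix `!![1, x; 0, 1]`. -/
def upperUni (x : F) : SL(2, F) := ⟨!![1, x; 0, 1], by simp [Matrix.det_fin_two]⟩

/-- The lower unitriangular matrix `!![1, 0; x, 1]`. -/
def lowerUni (x : F) : SL(2, F) := ⟨!![1, 0; x, 1], by simp [Matrix.det_fin_two]⟩

theorem upperUni_entries (x : F) : (upperUni x).1 0 0 = 1 ∧ (upperUni x).1 0 1 = x ∧
    (upperUni x).1 1 0 = 0 ∧ (upperUni x).1 1 1 = 1 := by simp [upperUni]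

theorem lowerUni_entries (x : F) : (lowerUni x).1 0 0 = 1 ∧ (lowerUni x).1 0 1 = 0 ∧
    (lowerUni x).1 1 0 = x ∧ (lowerUni x).1 1 1 = 1 := by simp [lowerUni]

theorem upperUni_mul (x y : F) : upperUni x * upperUni y = upperUni (x + y) := by
  apply sl2_ext <;> simp only [sl2_mul, upperUni_entries] <;> ring

/-- Three factors suffice when the lower left entry is nonzero; otherwise one lower unitriangular
multiplication makes it nonzero. -/
theorem eq_lower_upper (g : SL(2, F)) :
    ∃ a b c d : F, g = lowerUni a * (upperUni b * lowerUni c * upperUni d) := by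
  have key : ∀ g : SL(2, F), g.1 1 0 ≠ 0 →
      ∃ b c d : F, g = upperUni b * lowerUni c * upperUni d := by
    intro g hc
    have dg := sl2_det g
    refine ⟨(g.1 0 0 - 1) / g.1 1 0, g.1 1 0, (g.1 1 1 - 1) / g.1 1 0, ?_⟩
    apply sl2_ext <;> simp only [sl2_mul, lowerUni_entries, upperUni_entries] <;> field_simp
    · ring
    · linear_combination -dg
    · ring
    · ring
  by_cases hc : g.1 1 0 = 0
  · have dg := sl2_det g
    rw [hc] at dg
    have h0 : g.1 0 0 ≠ 0 := by
      intro h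
      rw [h] at dg
      simp at dg
    obtain ⟨b, c, d, h⟩ := key (lowerUni 1 * g) (by
      simpa only [sl2_mul, lowerUni_entries, hc, one_mul, add_zero, mul_zero] using h0)
    refine ⟨-1, b, c, d, ?_⟩
    rw [← h]
    apply sl2_ext <;> simp only [sl2_mul, lowerUni_entries] <;> ring
  · obtain ⟨b, c, d, h⟩ := key g hc
    refine ⟨0, b, c, d, ?_⟩
    rw [← h]
    apply sl2_ext <;> simp only [sl2_mul, lowerUni_entries] <;> ring

/-- The scalar elements of `SL₂(F)`. -/
def IsScalarElt (g : SL(2, F)) : Prop := g.1 0 1 = 0 ∧ g.1 1 0 = 0 ∧ g.1 0 0 = g.1 1 1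

theorem IsScalarElt.comm {g : SL(2, F)} (hg : IsScalarElt g) (h : SL(2, F)) : g * h = h * g := by
  obtain ⟨h1, h2, h3⟩ := hg
  apply sl2_ext <;> simp only [sl2_mul, h1, h2, h3] <;> ring

/-- For traceless matrices `a b + b a = tr (a b)`, and `a⁻¹ = -a`. -/
theorem anticommute_of_trace {a b : SL(2, F)} (ha : slTrace a = 0) (hb : slTrace b = 0)
    (hab : slTrace (a * b) = 0) : b * a = a⁻¹ * b := by
  simp only [slTrace, sl2_mul] at ha hb hab
  have ha' : a.1 1 1 = -a.1 0 0 := by linear_combination ha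
  have hb' : b.1 1 1 = -b.1 0 0 := by linear_combination hb
  rw [ha', hb'] at hab
  apply sl2_ext <;> simp only [sl2_mul, sl2_inv, ha', hb']
  · linear_combination hab
  · ring
  · ring
  · linear_combination hab

theorem not_commute_or_invert (h2 : (2 : F) ≠ 0) {x : SL(2, F)} (hx : slTrace x = 0) :
    ∃ g : SL(2, F), g * x ≠ x * g ∧ g * x ≠ x⁻¹ * g := by
  have dx := sl2_det x
  have hx' : x.1 1 1 = -x.1 0 0 := by unfold slTrace at hx; linear_combination hx
  have fin : x.1 0 0 = 0 → x.1 1 0 = 0 → False := by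
    intro h0 h1
    rw [h0, h1] at dx
    simp at dx
  refine ⟨upperUni 1, ?_, ?_⟩
  · intro h
    have q00 := congrArg (fun g : SL(2, F) => g.1 0 0) h
    have q01 := congrArg (fun g : SL(2, F) => g.1 0 1) h
    simp only [sl2_mul, upperUni_entries, hx'] at q00 q01
    refine fin ?_ (by linear_combination q00)
    apply mul_left_cancel₀ h2
    linear_combination -q01
  · intro h
    have q00 := congrArg (fun g : SL(2, F) => g.1 0 0) h
    have q10 := congrArg (fun g : SL(2, F) => g.1 1 0) h
    simp only [sl2_mul, sl2_inv, upperUni_entries, hx'] at q00 q10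
    have h1 : x.1 1 0 = 0 := by
      apply mul_left_cancel₀ h2
      linear_combination q10
    refine fin ?_ h1
    apply mul_left_cancel₀ h2
    linear_combination q00 - h1

/-- A line fixed by `H` would be fixed by the whole group, but `upperUni 1` and `lowerUni 1` have no
common line. -/
theorem irred_of_generates {H : Finset SL(2, F)}
    (hgen : Subgroup.closure (H : Set SL(2, F)) = ⊤) : Irred H := by
  intro u v h0
  by_contra! hall
  have key : ∀ g : SL(2, F), FixesLine g u v := by
    intro g
    have hg : g ∈ Subgroup.closure (H : Set SL(2, F)) := by rw [hgen]; trivial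
    induction hg using Subgroup.closure_induction with
    | mem a ha => exact hall a ha
    | one => exact fixesLine_one u v
    | mul a b _ _ ha hb => exact ha.mul h0 hb
    | inv a _ ha => exact ha.inv
  have e1 := key (upperUni 1)
  have e2 := key (lowerUni 1)
  simp only [FixesLine, upperUni_entries, lowerUni_entries] at e1 e2
  have hv : v * v = 0 := by linear_combination e1
  have hu : u * u = 0 := by linear_combination -e2
  rcases h0 with h | h
  · exact h (mul_self_eq_zero.1 hu)
  · exact h (mul_self_eq_zero.1 hv)

variable [DecidableEq F]

/-- A bounded power of a generating set contains a regular semisimple element of nonzero trace. -/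
theorem exists_regular_of_generates (h2 : (2 : F) ≠ 0) (h3 : (3 : F) ≠ 0) {H : Finset SL(2, F)}
    (h1 : 1 ∈ H) (hgen : Subgroup.closure (H : Set SL(2, F)) = ⊤) :
    ∃ g ∈ H ^ 10, slTrace g ≠ 0 ∧ slTrace g ^ 2 ≠ 4 := by
  by_contra! hcon
  have hirr := irred_of_generates hgen
  have hcube : ∀ g ∈ H ^ 10, slTrace g ^ 3 = 4 * slTrace g := by
    intro g hg
    by_cases h0 : slTrace g = 0
    · rw [h0]; ring
    · rw [pow_succ, hcon g hg h0]
  have m1 : ∀ {a}, a ∈ H → a ∈ H ^ 1 := fun h => by simpa using h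
  have up : ∀ {a : SL(2, F)} {m n : ℕ}, a ∈ H ^ m → m ≤ n → a ∈ H ^ n := fun h hmn =>
    Finset.pow_subset_pow_right h1 hmn h
  -- Otherwise `g - e` with `e = ±1` is a nonzero nilpotent, and some `h ∈ H` moves its line. The
  -- traces of `gⁿ h` are `eⁿ (t + n b)`; for `n = 0, …, 3` they are roots of `X³ - 4 X`, and the
  -- third difference `6 b³` must vanish. The longest word, `g³ h`, has length 10.
  have hscalar : ∀ g ∈ H ^ 3, slTrace g ^ 2 = 4 → IsScalarElt g := by
    intro g hg hg4
    by_contra hns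
    have hd := sl2_det g
    obtain ⟨e, he⟩ : ∃ e, e = slTrace g / 2 := ⟨_, rfl⟩
    have htr : slTrace g = 2 * e := by rw [he]; field_simp
    have he2 : e ^ 2 = 1 := by
      apply mul_left_cancel₀ (pow_ne_zero 2 h2)
      rw [htr] at hg4
      linear_combination hg4
    unfold slTrace at htr
    obtain ⟨u, v, huv, hfix⟩ := exists_fixesLine_of_nilpotent (p := g.1 0 0 - e) (q := g.1 0 1)
      (r := g.1 1 0) (by
        by_contra! h
        obtain ⟨h5, h6, h7⟩ := h
        exact hns ⟨h6, h7, by linear_combination 2 * h5 - htr⟩) (by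
        linear_combination g.1 0 0 * htr - hd + he2)
    obtain ⟨h, hh, hf⟩ := hirr u v huv
    apply hf
    apply hfix
    have c0 := hcube h (up (m1 hh) (by norm_num))
    have c1 := hcube _ (up (mul_mem_finset_pow hg (m1 hh)) (by norm_num))
    have c2 := hcube _ (up (mul_mem_finset_pow hg (mul_mem_finset_pow hg (m1 hh))) (by norm_num))
    have c3 := hcube _ (up (mul_mem_finset_pow hg
      (mul_mem_finset_pow hg (mul_mem_finset_pow hg (m1 hh)))) (by norm_num))
    have rec' : ∀ k : SL(2, F), slTrace (g * (g * k)) = 2 * e * slTrace (g * k) - slTrace k := by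
      intro k
      simp only [slTrace, sl2_mul]
      linear_combination (g.1 0 0 * k.1 0 0 + g.1 0 1 * k.1 1 0 + g.1 1 0 * k.1 0 1 +
        g.1 1 1 * k.1 1 1) * htr - (k.1 0 0 + k.1 1 1) * hd
    rw [rec' (g * h), rec' h] at c3
    rw [rec' h] at c2
    obtain ⟨b, hb⟩ : ∃ b, b = e * slTrace (g * h) - slTrace h := ⟨_, rfl⟩
    have ht1 : slTrace (g * h) = e * (slTrace h + b) := by
      rw [hb]; linear_combination (-slTrace (g * h)) * he2
    rw [ht1] at c1 c2 c3
    generalize ht : slTrace h = t at *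
    have d1 : (t + b) ^ 3 = 4 * (t + b) := by
      linear_combination e * c1 - ((e ^ 2 + 1) * (t + b) ^ 3 - 4 * (t + b)) * he2
    have d2 : (t + 2 * b) ^ 3 = 4 * (t + 2 * b) := by
      have : 2 * e * (e * (t + b)) - t = t + 2 * b := by linear_combination 2 * (t + b) * he2
      rwa [this] at c2
    have d3 : (t + 3 * b) ^ 3 = 4 * (t + 3 * b) := by
      have : 2 * e * (2 * e * (e * (t + b)) - t) - e * (t + b) = e * (t + 3 * b) := by
        linear_combination 4 * e * (t + b) * he2
      rw [this] at c3
      linear_combination e * c3 - ((e ^ 2 + 1) * (t + 3 * b) ^ 3 - 4 * (t + 3 * b)) * he2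
    have hb0 : b = 0 := by
      have h6 : (2 * 3 : F) * b ^ 3 = 0 := by linear_combination d3 - 3 * d2 + 3 * d1 - c0
      simpa [h2, h3] using h6
    rw [hb0, add_zero] at ht1
    simp only [slTrace, sl2_mul] at ht1 ht
    linear_combination ht1 - h.1 1 1 * htr - e * ht
  have hzero : ∀ g ∈ H ^ 3, ¬ IsScalarElt g → slTrace g = 0 := by
    intro g hg hns
    by_contra h0
    exact hns (hscalar g hg (hcon g (up hg (by norm_num)) h0))
  obtain ⟨x, hx, hxf⟩ := hirr 1 0 (by simp)
  have hxs : ¬ IsScalarElt x := fun h => hxf ((fixesLine_one_zero x).2 h.2.1)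
  have hx0 := hzero x (up (m1 hx) (by norm_num)) hxs
  obtain ⟨y, hy, hxy⟩ : ∃ y ∈ H, y * x ≠ x * y := by
    by_contra! hall
    have key : ∀ g : SL(2, F), g * x = x * g := by
      intro g
      have hg : g ∈ Subgroup.closure (H : Set SL(2, F)) := by rw [hgen]; trivial
      induction hg using Subgroup.closure_induction with
      | mem a ha => exact hall a ha
      | one => simp
      | mul a b _ _ ha hb => exact (show Commute _ _ from ha).mul_left hb
      | inv a _ ha => exact (show Commute _ _ from ha).inv_left
    obtain ⟨g, hg, -⟩ := not_commute_or_invert h2 hx0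
    exact hg (key g)
  have hy0 := hzero y (up (m1 hy) (by norm_num)) fun h => hxy (h.comm x)
  have hxyH := mul_mem_finset_pow (m1 hx) (m1 hy)
  have hxy0 : slTrace (x * y) = 0 := hzero _ (up hxyH (by norm_num)) fun h => hxy (by
    have := h.comm x
    rw [mul_assoc] at this
    exact mul_left_cancel this)
  have hyx : y * x = x⁻¹ * y := anticommute_of_trace hx0 hy0 hxy0
  have hxy' : x * y = y * x⁻¹ := by
    rw [eq_mul_inv_iff_mul_eq, mul_assoc, hyx, mul_inv_cancel_left]
  -- If `z`, `x z`, `y z`, `x y z` are all non-scalar, `z` anticommutes with `x`, `y` and `x y`; but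
  -- anticommuting with `x` and `y` means commuting with `x y`. If one is scalar, `z` conjugates `x`
  -- to `x` or `x⁻¹`. Then so does the whole group, which is absurd.
  have hall : ∀ z ∈ H, z * x = x * z ∨ z * x = x⁻¹ * z := by
    intro z hz
    by_cases s1 : IsScalarElt z
    · exact Or.inl (s1.comm x)
    by_cases s2 : IsScalarElt (x * z)
    · left
      have := s2.comm x
      rw [mul_assoc] at this
      exact mul_left_cancel this
    by_cases s3 : IsScalarElt (y * z)
    · right
      apply mul_left_cancel (a := y)
      rw [← mul_assoc, s3.comm x, ← mul_assoc, hxy', mul_assoc]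
    by_cases s4 : IsScalarElt (x * y * z)
    · right
      apply mul_left_cancel (a := x * y)
      rw [← mul_assoc, s4.comm x]
      rw [show x * y * z = y * x⁻¹ * z by rw [hxy']]
      group
    exfalso
    have a1 := anticommute_of_trace hx0 (hzero z (up (m1 hz) (by norm_num)) s1)
      (hzero _ (up (mul_mem_finset_pow (m1 hx) (m1 hz)) (by norm_num)) s2)
    have a2 := anticommute_of_trace hy0 (hzero z (up (m1 hz) (by norm_num)) s1)
      (hzero _ (up (mul_mem_finset_pow (m1 hy) (m1 hz)) (by norm_num)) s3)
    have a3 := anticommute_of_trace hxy0 (hzero z (up (m1 hz) (by norm_num)) s1)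
      (hzero _ (mul_mem_finset_pow hxyH (m1 hz)) s4)
    rw [← mul_assoc, a1, mul_assoc, a2, ← mul_assoc] at a3
    have a4 := mul_right_cancel a3
    rw [← mul_inv_rev, inv_inj] at a4
    exact hxy a4
  have key : ∀ g : SL(2, F), SemiconjBy g x x ∨ SemiconjBy g x x⁻¹ := by
    intro g
    have hg : g ∈ Subgroup.closure (H : Set SL(2, F)) := by rw [hgen]; trivial
    induction hg using Subgroup.closure_induction with
    | mem a ha => exact hall a ha
    | one => exact Or.inl (SemiconjBy.one_left x)
    | mul a b _ _ ha hb =>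
      rcases ha with ha | ha <;> rcases hb with hb | hb
      · exact Or.inl (ha.mul_left hb)
      · exact Or.inr (ha.inv_right.mul_left hb)
      · exact Or.inr (ha.mul_left hb)
      · exact Or.inl (by simpa using ha.inv_right.mul_left hb)
    | inv a _ ha =>
      rcases ha with ha | ha
      · exact Or.inl ha.inv_symm_left
      · exact Or.inr (by simpa using ha.inv_right.inv_symm_left)
  obtain ⟨g, hg, hg'⟩ := not_commute_or_invert h2 hx0
  rcases key g with h | h
  · exact hg h
  · exact hg' h

end Escape

/-! ### Very large sets fill the group -/

section LargeSets

variable {F : Type*} [Field F] [Fintype F] [DecidableEq F]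

/-- Proportional `v` and `w` giving the same nonzero value would be equal, so the two equations are
independent. -/
theorem card_line_le {v w : F × F} (hvw : v ≠ w) {a : F} (ha : a ≠ 0) :
    (Finset.univ.filter fun u : F × F => u.1 * v.1 + u.2 * v.2 = a ∧
      u.1 * w.1 + u.2 * w.2 = a).card ≤ 1 := by
  rw [Finset.card_le_one]
  intro u hu u' hu'
  simp only [Finset.mem_filter, Finset.mem_univ, true_and] at hu hu'
  obtain ⟨e1, e2⟩ := hu
  obtain ⟨f1, f2⟩ := hu'
  have hdet : v.1 * w.2 - v.2 * w.1 ≠ 0 := by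
    intro h0
    apply hvw
    ext
    · apply mul_left_cancel₀ ha
      linear_combination u.2 * h0 + w.1 * e1 - v.1 * e2
    · apply mul_left_cancel₀ ha
      linear_combination (-u.1) * h0 + w.2 * e1 - v.2 * e2
  ext
  · apply mul_left_cancel₀ hdet
    linear_combination w.2 * e1 - v.2 * e2 - w.2 * f1 + v.2 * f2
  · apply mul_left_cancel₀ hdet
    linear_combination v.1 * e2 - w.1 * e1 - v.1 * f2 + w.1 * f1

theorem card_single_line {v : F × F} (hv : v ≠ 0) (a : F) :
    (Finset.univ.filter fun u : F × F => u.1 * v.1 + u.2 * v.2 = a).card = Fintype.card F := by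
  rw [← Finset.card_univ]
  have hv' : v.1 ≠ 0 ∨ v.2 ≠ 0 := by
    by_contra! h
    exact hv (Prod.ext h.1 h.2)
  rcases hv' with h | h
  · refine Finset.card_bij' (fun u _ => u.2) (fun t _ => ((a - t * v.2) / v.1, t)) ?_ ?_ ?_ ?_
    · simp
    · intro t _
      simp only [Finset.mem_filter, Finset.mem_univ, true_and]
      field_simp
      ring
    · intro u hu
      simp only [Finset.mem_filter, Finset.mem_univ, true_and] at hu
      ext
      · simp only
        field_simp
        linear_combination -hu
      · rfl
    · simp
  · refine Finset.card_bij' (fun u _ => u.1) (fun t _ => (t, (a - t * v.1) / v.2)) ?_ ?_ ?_ ?_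
    · simp
    · intro t _
      simp only [Finset.mem_filter, Finset.mem_univ, true_and]
      field_simp
      ring
    · intro u hu
      simp only [Finset.mem_filter, Finset.mem_univ, true_and] at hu
      ext
      · rfl
      · simp only
        field_simp
        linear_combination -hu
    · simp

/-- Two large sets of vectors in `F²` realize every nonzero value of the dot product. -/
theorem exists_dot_eq {U V : Finset (F × F)} (hV : 0 ∉ V)
    (hUV : Fintype.card F ^ 3 < U.card * V.card) {a : F} (ha : a ≠ 0) :
    ∃ u ∈ U, ∃ v ∈ V, u.1 * v.1 + u.2 * v.2 = a := by
  by_contra! hcon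
  -- Second moment method: `n u` counts the `v ∈ V` with dot product `a`. If it vanishes on `U`,
  -- Cauchy–Schwarz on the complement of `U` contradicts the size of `U` and `V`.
  set n : F × F → ℕ := fun u => (V.filter fun v => u.1 * v.1 + u.2 * v.2 = a).card with hn
  set q := Fintype.card F with hq
  have hsum : ∑ u, n u = V.card * q := by
    simp only [hn, Finset.card_filter]
    rw [Finset.sum_comm]
    simp only [← Finset.card_filter]
    rw [Finset.sum_congr rfl fun v hv => card_single_line (a := a) (v := v) fun h => hV (h ▸ hv)]
    simp [hq]
  have hsq : ∑ u, n u ^ 2 ≤ V.card ^ 2 + V.card * q := by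
    have e : ∀ u, n u ^ 2 = ∑ v ∈ V, ∑ w ∈ V,
        if u.1 * v.1 + u.2 * v.2 = a ∧ u.1 * w.1 + u.2 * w.2 = a then 1 else 0 := by
      intro u
      simp only [hn, Finset.card_filter, pow_two, Finset.sum_mul_sum, ite_and]
      refine Finset.sum_congr rfl fun v _ => Finset.sum_congr rfl fun w _ => ?_
      split_ifs <;> simp
    simp only [e]
    rw [Finset.sum_comm]
    have : ∀ v ∈ V, ∑ u : F × F, ∑ w ∈ V,
        (if u.1 * v.1 + u.2 * v.2 = a ∧ u.1 * w.1 + u.2 * w.2 = a then 1 else 0) ≤ V.card + q := by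
      intro v hv
      have hv0 : v ≠ 0 := fun h => hV (h ▸ hv)
      rw [Finset.sum_comm]
      simp only [← Finset.card_filter]
      calc ∑ w ∈ V, (Finset.univ.filter fun u : F × F => u.1 * v.1 + u.2 * v.2 = a ∧
            u.1 * w.1 + u.2 * w.2 = a).card
          ≤ ∑ w ∈ V, (1 + if v = w then q else 0) := by
            refine Finset.sum_le_sum fun w _ => ?_
            by_cases hvw : v = w
            · subst hvw
              simp only [and_self, if_true]
              rw [card_single_line hv0 a]; omega
            · simpa [hvw] using card_line_le hvw ha
        _ ≤ V.card + q := by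
            rw [Finset.sum_add_distrib, Finset.sum_ite_eq]
            simp [hv]
    refine (Finset.sum_le_sum this).trans ?_
    simp only [Finset.sum_const, smul_eq_mul]
    exact le_of_eq (by ring)
  have hzero : ∀ u ∈ U, n u = 0 := by
    intro u hu
    simp only [hn, Finset.card_eq_zero, Finset.filter_eq_empty_iff]
    exact fun v hv => hcon u hu v hv
  have hsum' : ∑ u ∈ Uᶜ, n u = V.card * q := by
    rw [← hsum, ← Finset.sum_add_sum_compl U n, Finset.sum_eq_zero hzero, zero_add]
  have hcs : (V.card * q) ^ 2 ≤ Uᶜ.card * (V.card ^ 2 + V.card * q) := by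
    refine (congrArg (· ^ 2) hsum').ge.trans ?_
    refine (sq_sum_le_card_mul_sum_sq (s := Uᶜ) (f := n)).trans (Nat.mul_le_mul_left _ ?_)
    exact (Finset.sum_le_sum_of_subset (Finset.subset_univ _)).trans hsq
  have hcompl : Uᶜ.card + U.card = q ^ 2 := by
    rw [Finset.card_compl_add_card, Fintype.card_prod, hq, pow_two]
  generalize Uᶜ.card = c at *
  generalize U.card = m at *
  have hV1 : 0 < V.card := by
    by_contra! h0
    have : V.card = 0 := by omega
    simp [this] at hUV
  generalize V.card = k at *
  have h1 : k * q ^ 2 ≤ c * (k + q) := by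
    apply Nat.le_of_mul_le_mul_left _ hV1
    calc k * (k * q ^ 2) = (k * q) ^ 2 := by ring
      _ ≤ _ := hcs
      _ = _ := by ring
  have h2 : c * q ≤ q ^ 3 := by
    calc c * q ≤ q ^ 2 * q := Nat.mul_le_mul_right _ (by omega)
      _ = _ := by ring
  rw [← hcompl] at h1
  nlinarith

theorem exists_bilinear {X Y : Finset F} (hY : 0 ∉ Y)
    (hXY : Fintype.card F ^ 3 < X.card ^ 2 * Y.card ^ 2) {a : F} (ha : a ≠ 0) :
    ∃ x ∈ X, ∃ x' ∈ X, ∃ y ∈ Y, ∃ y' ∈ Y, x * y + x' * y' = a := by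
  obtain ⟨u, hu, v, hv, h⟩ := exists_dot_eq (U := X ×ˢ X) (V := Y ×ˢ Y)
    (fun h => hY (Finset.mem_product.1 h).1)
    (by rwa [Finset.card_product, Finset.card_product, ← pow_two, ← pow_two]) ha
  rw [Finset.mem_product] at hu hv
  exact ⟨u.1, hu.1, u.2, hu.2, v.1, hv.1, v.2, hv.2, h⟩

/-- Conjugating `upperUni x` by an upper triangular `b` multiplies `x` by the square of the upper
left entry of `b`. With `X` and `Y` the available shifts and squares, `exists_bilinear` gives every
nonzero `z` as `x y + x' y'`, of word length 6 + 6. -/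
theorem upperUni_mem_of_large {H : Finset SL(2, F)} (hH : H⁻¹ = H) (h1 : 1 ∈ H)
    (hlarge : 16 * Fintype.card F ^ 11 < H.card ^ 4) (z : F) : upperUni z ∈ H ^ 12 := by
  set q := Fintype.card F with hq
  have hq2 : 2 ≤ q := Fintype.one_lt_card
  by_cases hz : z = 0
  · rw [hz, show upperUni (0 : F) = 1 by
      apply sl2_ext <;> simp only [upperUni_entries, sl2_one]]
    exact Finset.one_mem_pow h1
  set X : Finset F := Finset.univ.filter fun x => upperUni x ∈ H ^ 2 with hX
  set B : Finset SL(2, F) := (H ^ 2).filter fun g => g.1 1 0 = 0 with hB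
  set Y : Finset F := B.image fun g => g.1 0 0 ^ 2 with hY
  -- The first column labels the cosets of the unitriangular group.
  have hXc : H.card ≤ X.card * q ^ 2 := by
    refine (Finset.card_le_mul_card_image (f := fun g => (g.1 0 0, g.1 1 0)) _ X.card ?_).trans
      (Nat.mul_le_mul_left _ ?_)
    · intro l hl
      obtain ⟨x, hx, rfl⟩ := Finset.mem_image.1 hl
      have key : ∀ h : SL(2, F), h.1 0 0 = x.1 0 0 → h.1 1 0 = x.1 1 0 →
          x⁻¹ * h = upperUni ((x⁻¹ * h).1 0 1) := by
        intro h e0 e1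
        have dx := sl2_det x
        have dh := sl2_det h
        rw [e0, e1] at dh
        apply sl2_ext <;> simp only [upperUni_entries, sl2_mul, sl2_inv, e0, e1]
        · linear_combination dx
        · ring
        · linear_combination dh
      refine Finset.card_le_card_of_injOn (fun h => (x⁻¹ * h).1 0 1) ?_ ?_
      · intro h hh
        simp only [Finset.coe_filter, Set.mem_ofPred_eq, Prod.mk.injEq] at hh
        simp only [hX, Finset.coe_filter, Set.mem_ofPred_eq, Finset.mem_univ, true_and]
        rw [← key h hh.2.1 hh.2.2]
        exact inv_mul_mem_sq hH hx hh.1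
      · intro h hh k hk hhk
        simp only [Finset.coe_filter, Set.mem_ofPred_eq, Prod.mk.injEq] at hh hk hhk
        apply mul_left_cancel (a := x⁻¹)
        rw [key h hh.2.1 hh.2.2, key k hk.2.1 hk.2.2, hhk]
    · refine (Finset.card_le_univ _).trans ?_
      rw [Fintype.card_prod, hq, pow_two]
  -- Cosets of the Borel subgroup are points of the projective line, with `none` as infinity.
  have hBc : H.card ≤ B.card * (q + 1) := by
    refine (Finset.card_le_mul_card_image (f := fun g => if g.1 1 0 = 0 then none else
      some (g.1 0 0 / g.1 1 0)) _ B.card ?_).trans (Nat.mul_le_mul_left _ ?_)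
    · intro l hl
      obtain ⟨x, hx, rfl⟩ := Finset.mem_image.1 hl
      refine Finset.card_le_card_of_injOn (fun h => x⁻¹ * h) ?_ (mul_right_injective _).injOn
      intro h hh
      simp only [Finset.coe_filter, Set.mem_ofPred_eq] at hh
      simp only [hB, Finset.coe_filter, Set.mem_ofPred_eq]
      refine ⟨inv_mul_mem_sq hH hx hh.1, ?_⟩
      have h2 := hh.2
      simp only [sl2_mul, sl2_inv]
      split_ifs at h2 with c1 c2 c2
      · rw [c1, c2]; ring
      · simp only [Option.some.injEq] at h2
        field_simp at h2
        linear_combination -h2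
    · refine (Finset.card_le_univ _).trans ?_
      rw [Fintype.card_option]
  -- An upper triangular element is determined by its upper right entry and the sign of a square
  -- root.
  have hYc : B.card ≤ 2 * q * Y.card := by
    refine Finset.card_le_mul_card_image _ (2 * q) ?_
    intro l _
    refine (Finset.card_le_mul_card_image (f := fun g => g.1 0 1) _ 2 ?_).trans
      (Nat.mul_le_mul_left _ (Finset.card_le_univ _))
    intro m _
    refine le_trans (Finset.card_le_card_of_injOn (t := Finset.univ.filter fun x : F => x ^ 2 = l)
      (fun g => g.1 0 0) ?_ ?_) (card_quadratic_le_two _ 0 (-l) ?_)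
    · intro g hg
      simp only [Finset.coe_filter, Set.mem_ofPred_eq, Finset.mem_filter] at hg
      simpa using hg.1.2
    · intro g hg k hk hgk
      simp only [Finset.coe_filter, Set.mem_ofPred_eq, Finset.mem_filter, hB] at hg hk hgk
      have dg := sl2_det g
      have dk := sl2_det k
      rw [hg.1.1.2, hgk] at dg
      rw [hk.1.1.2] at dk
      have hne : k.1 0 0 ≠ 0 := by
        intro h
        rw [h] at dk
        simp at dk
      refine sl2_ext hgk (hg.2.trans hk.2.symm) (hg.1.1.2.trans hk.1.1.2.symm) ?_
      apply mul_left_cancel₀ hne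
      linear_combination dg - dk
    · intro x hx
      simp only [Finset.mem_filter, Finset.mem_univ, true_and] at hx
      linear_combination hx
  have hY0 : 0 ∉ Y := by
    intro h0
    obtain ⟨g, hg, hg0⟩ := Finset.mem_image.1 h0
    have dg := sl2_det g
    rw [(Finset.mem_filter.1 hg).2, pow_eq_zero_iff (by norm_num) |>.1 hg0] at dg
    simp at dg
  have hXY : q ^ 3 < X.card ^ 2 * Y.card ^ 2 := by
    have h4 : H.card ≤ 4 * q ^ 2 * Y.card := by
      calc H.card ≤ B.card * (q + 1) := hBc
        _ ≤ (2 * q * Y.card) * (2 * q) := Nat.mul_le_mul hYc (by omega)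
        _ = _ := by ring
    have h5 : H.card ^ 4 ≤ 16 * q ^ 8 * (X.card ^ 2 * Y.card ^ 2) := by
      calc H.card ^ 4 = H.card ^ 2 * H.card ^ 2 := by ring
        _ ≤ (X.card * q ^ 2) ^ 2 * (4 * q ^ 2 * Y.card) ^ 2 :=
          Nat.mul_le_mul (Nat.pow_le_pow_left hXc 2) (Nat.pow_le_pow_left h4 2)
        _ = _ := by ring
    apply Nat.lt_of_mul_lt_mul_left (a := 16 * q ^ 8)
    calc 16 * q ^ 8 * q ^ 3 = 16 * q ^ 11 := by ring
      _ < _ := hlarge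
      _ ≤ _ := h5
  obtain ⟨x, hx, x', hx', y, hy, y', hy', rfl⟩ := exists_bilinear hY0 hXY hz
  have key : ∀ x ∈ X, ∀ y ∈ Y, upperUni (x * y) ∈ H ^ 6 := by
    intro x hx y hy
    obtain ⟨b, hb, rfl⟩ := Finset.mem_image.1 hy
    obtain ⟨hb2, hb0⟩ := Finset.mem_filter.1 hb
    have hx2 := (Finset.mem_filter.1 hx).2
    have := mul_mem_finset_pow (mul_mem_finset_pow hb2 hx2) (inv_mem_finset_pow hH hb2)
    convert this using 1
    have db := sl2_det b
    rw [hb0] at db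
    apply sl2_ext <;> simp only [sl2_mul, sl2_inv, upperUni_entries, hb0]
    · linear_combination -db
    · ring
    · ring
    · linear_combination -db
  rw [← upperUni_mul]
  exact mul_mem_finset_pow (key x hx y hy) (key x' hx' y' hy')

theorem lowerUni_mem_of_large {H : Finset SL(2, F)} (hH : H⁻¹ = H) (h1 : 1 ∈ H)
    (hlarge : 16 * Fintype.card F ^ 11 < H.card ^ 4) (z : F) : lowerUni z ∈ H ^ 12 := by
  set w : SL(2, F) := ⟨!![0, 1; -1, 0], by simp [Matrix.det_fin_two]⟩ with hw
  set f : SL(2, F) →* SL(2, F) := (MulAut.conj w).toMonoidHom with hfdef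
  have hfa (g) : f g = w * g * w⁻¹ := by simp [hfdef]
  have hinj : Function.Injective f := (MulAut.conj w).injective
  have hS' : (H.image f)⁻¹ = H.image f := by
    rw [← Finset.image_inv (f := f), hH]
  have := upperUni_mem_of_large hS' (Finset.mem_image.2 ⟨1, h1, map_one f⟩)
    (by rwa [Finset.card_image_of_injective _ hinj]) (-z)
  rw [← Finset.image_pow] at this
  obtain ⟨g, hg, hgz⟩ := Finset.mem_image.1 this
  convert hg
  apply hinj
  rw [hgz, hfa]
  have hwe : w.1 0 0 = 0 ∧ w.1 0 1 = 1 ∧ w.1 1 0 = -1 ∧ w.1 1 1 = 0 := by simp [hw]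
  apply sl2_ext <;> simp only [sl2_mul, sl2_inv, lowerUni_entries, upperUni_entries, hwe] <;> ring

/-- A very large symmetric set covers the group in boundedly many steps. -/
theorem mem_pow_of_large {H : Finset SL(2, F)} (hH : H⁻¹ = H) (h1 : 1 ∈ H)
    (hlarge : 16 * Fintype.card F ^ 11 < H.card ^ 4) {n : ℕ} (hn : 48 ≤ n)
    (g : SL(2, F)) : g ∈ H ^ n := by
  obtain ⟨a, b, c, d, hg⟩ := eq_lower_upper g
  obtain ⟨k, hk⟩ : ∃ k, k = 12 := ⟨_, rfl⟩
  have hu := upperUni_mem_of_large hH h1 hlarge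
  have hl := lowerUni_mem_of_large hH h1 hlarge
  rw [← hk] at hu hl
  have h := mul_mem_finset_pow (hl a)
    (mul_mem_finset_pow (mul_mem_finset_pow (hu b) (hl c)) (hu d))
  rw [hg]
  exact Finset.pow_subset_pow_right h1 (by omega) h

end LargeSets

/-! ### The product theorem and its iteration -/

section Iteration

theorem arith_growth {c h N : ℕ} (hc : 1 ≤ c) (hh : c ^ 2 ≤ h) (h3 : h ^ 3 ≤ c * N ^ 2) :
    h ^ 56 ≤ N ^ 55 := by
  have hh1 : 1 ≤ h := (Nat.one_le_pow _ _ hc).trans hh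
  have hN : 1 ≤ N := by
    rcases Nat.eq_zero_or_pos N with h0 | h0
    · subst h0
      have : 1 ≤ h ^ 3 := Nat.one_le_pow _ _ hh1
      omega
    · exact h0
  have hck : c ^ 27 ≤ h ^ 25 := by
    calc c ^ 27 ≤ c ^ 50 := Nat.pow_le_pow_right hc (by norm_num)
      _ = (c ^ 2) ^ 25 := by rw [← pow_mul]
      _ ≤ h ^ 25 := Nat.pow_le_pow_left hh 25
  refine le_trans (b := N ^ 54) ?_ (Nat.pow_le_pow_right hN (by norm_num))
  refine le_of_mul_le_mul_left (a := c ^ 27) ?_ (by positivity)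
  calc c ^ 27 * h ^ 56 ≤ h ^ 25 * h ^ 56 := Nat.mul_le_mul_right _ hck
    _ = (h ^ 3) ^ 27 := by rw [← pow_add, ← pow_mul]
    _ ≤ (c * N ^ 2) ^ 27 := Nat.pow_le_pow_left h3 27
    _ = c ^ 27 * N ^ 54 := by rw [mul_pow, ← pow_mul]

/-- The powers 6 and 11 cancel `q ^ 66` and leave `h ^ 57` against a constant times `N ^ 55`; one
factor `h` absorbs the constant. This is the origin of 56/55. -/
theorem arith_growth' {c h N q : ℕ} (hh : 16 ^ 6 * c ^ 11 ≤ h) (hq : 0 < q) (h0 : 0 < h)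
    (h4 : h ^ 4 ≤ 16 * q ^ 11) (h3 : q ^ 6 * h ^ 3 ≤ c * N ^ 5) : h ^ 56 ≤ N ^ 55 := by
  refine le_of_mul_le_mul_left (a := h) ?_ h0
  refine le_trans ?_ (Nat.mul_le_mul_right _ hh)
  refine le_of_mul_le_mul_left (a := q ^ 66) ?_ (by positivity)
  calc q ^ 66 * (h * h ^ 56) = (h ^ 4) ^ 6 * (q ^ 6 * h ^ 3) ^ 11 := by ring
    _ ≤ (16 * q ^ 11) ^ 6 * (c * N ^ 5) ^ 11 :=
      Nat.mul_le_mul (Nat.pow_le_pow_left h4 6) (Nat.pow_le_pow_left h3 11)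
    _ = q ^ 66 * (16 ^ 6 * c ^ 11 * N ^ 55) := by
      rw [mul_pow, mul_pow, ← pow_mul, ← pow_mul]
      ring

/-- Helfgott's product theorem for `SL₂` over a finite field of characteristic at least `5`. -/
theorem exists_product_theorem : ∃ k n₀ : ℕ, 1 < k ∧ ∀ {F : Type} [Field F] [Fintype F] [DecidableEq F],
    (2 : F) ≠ 0 → (3 : F) ≠ 0 → ∀ H : Finset SL(2, F), H⁻¹ = H → 1 ∈ H →
      Subgroup.closure (H : Set SL(2, F)) = ⊤ → n₀ ≤ H.card →
        (∀ g, g ∈ H ^ k) ∨ H.card ^ 56 ≤ (H ^ k).card ^ 55 := by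
  obtain ⟨c₁, hc₁⟩ : ∃ c, c = 2519424 := ⟨_, rfl⟩
  obtain ⟨c₂, hc₂⟩ : ∃ c, c = 161243136 := ⟨_, rfl⟩
  obtain ⟨k, hk⟩ : ∃ k, k = 96 := ⟨_, rfl⟩
  refine ⟨k, c₁ ^ 2 + 16 ^ 6 * c₂ ^ 11, by omega, ?_⟩
  intro F _ _ _ h2 h3 H hH h1 hgen hcard
  rcases lt_or_ge (16 * Fintype.card F ^ 11) (H.card ^ 4) with hl | hl
  · exact Or.inl (mem_pow_of_large hH h1 hl (by omega))
  · right
    obtain ⟨g, hg, hg0, hg4⟩ := exists_regular_of_generates h2 h3 h1 hgen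
    rcases growth_of_escape h2 hH h1 hgen (irred_of_generates hgen) hg hg0 hg4 with h | h
    · rw [← hc₁, ← hk] at h
      exact arith_growth (by omega) (by omega) h
    · rw [← hc₂, ← hk] at h
      exact arith_growth' (by omega) Fintype.card_pos (Finset.card_pos.2 ⟨1, h1⟩) hl h

theorem closure_finset_pow {G : Type*} [Group G] [DecidableEq G] {H : Finset G} (h1 : 1 ∈ H)
    (hgen : Subgroup.closure (H : Set G) = ⊤) {n : ℕ} (hn : n ≠ 0) :
    Subgroup.closure ((H ^ n : Finset G) : Set G) = ⊤ := by
  rw [eq_top_iff, ← hgen]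
  exact Subgroup.closure_mono (Finset.coe_subset.2 (Finset.subset_pow h1 hn))

/-- Powers of a generating set grow at least linearly until they fill the group. -/
theorem lt_card_pow_or_forall_mem {G : Type*} [Group G] [DecidableEq G] {H : Finset G}
    (hH : H⁻¹ = H) (h1 : 1 ∈ H) (hgen : Subgroup.closure (H : Set G) = ⊤) (n : ℕ) :
    n < (H ^ n).card ∨ ∀ g, g ∈ H ^ n := by
  induction n with
  | zero => left; simp
  | succ n ih =>
    have hsub : H ^ n ⊆ H ^ (n + 1) := Finset.pow_subset_pow_right h1 (Nat.le_succ n)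
    rcases ih with ih | ih
    · by_cases heq : H ^ n = H ^ (n + 1)
      · right
        intro g
        rw [← heq]
        have hg : g ∈ Subgroup.closure (H : Set G) := by rw [hgen]; trivial
        induction hg using Subgroup.closure_induction_right with
        | one => exact Finset.one_mem_pow h1
        | mul_right x y _ hy hx =>
          rw [heq, pow_succ]
          exact Finset.mul_mem_mul hx hy
        | mul_inv_cancel x y _ hy hx =>
          rw [heq, pow_succ]
          refine Finset.mul_mem_mul hx ?_
          rw [← hH]
          exact Finset.inv_mem_inv hy
      · left
        have := Finset.card_lt_card (hsub.ssubset_of_ne heq)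
        omega
    · exact Or.inr fun g => hsub (ih g)

/-- The lower bound is `2 ^ ((56/55) ^ m)`, with both sides raised to the power `55 ^ m` to stay
among integers. -/
theorem exists_iterated_growth : ∃ k n₀ : ℕ, 1 < k ∧ 81 ≤ n₀ ∧
    ∀ {F : Type} [Field F] [Fintype F] [DecidableEq F], (2 : F) ≠ 0 → (3 : F) ≠ 0 →
      ∀ H : Finset SL(2, F), H⁻¹ = H → 1 ∈ H → Subgroup.closure (H : Set SL(2, F)) = ⊤ →
        ∀ m : ℕ, (∀ g, g ∈ H ^ (n₀ * k ^ m)) ∨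
          (2 ^ 56 ^ m ≤ (H ^ (n₀ * k ^ m)).card ^ 55 ^ m ∧
            n₀ ≤ (H ^ (n₀ * k ^ m)).card) := by
  obtain ⟨k, n₀, hk, hn₀⟩ := exists_product_theorem
  -- The extra `81 = 3 ^ 4` bounds the orders of the groups for `p ≤ 3`, where the product theorem
  -- does not apply.
  obtain ⟨n₁, hn₁⟩ : ∃ n₁, n₁ = n₀ + 81 := ⟨_, rfl⟩
  refine ⟨k, n₁, hk, by omega, ?_⟩
  intro F _ _ _ h2 h3 H hH h1 hgen m
  induction m with
  | zero =>
    rcases lt_card_pow_or_forall_mem hH h1 hgen n₁ with h | h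
    · right
      simp only [pow_zero, mul_one, pow_one]
      omega
    · left
      simpa using h
  | succ m ih =>
    have hpow : H ^ (n₁ * k ^ (m + 1)) = (H ^ (n₁ * k ^ m)) ^ k := by
      rw [← pow_mul, pow_succ, mul_assoc]
    rw [hpow]
    set S := H ^ (n₁ * k ^ m) with hSdef
    have hS1 : (1 : SL(2, F)) ∈ S := Finset.one_mem_pow h1
    have hsub : S ⊆ S ^ k := Finset.subset_pow hS1 (by omega)
    rcases ih with ih | ⟨ih, ihc⟩
    · exact Or.inl fun g => hsub (ih g)
    · rcases hn₀ h2 h3 S (inv_finset_pow hH _) hS1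
        (closure_finset_pow h1 hgen (mul_ne_zero (by omega) (pow_ne_zero _ (by omega)))) (by omega) with h | h
      · exact Or.inl h
      · right
        refine ⟨?_, ihc.trans (Finset.card_le_card hsub)⟩
        calc 2 ^ 56 ^ (m + 1) = (2 ^ 56 ^ m) ^ 56 := by rw [← pow_mul, pow_succ]
          _ ≤ (S.card ^ 55 ^ m) ^ 56 := Nat.pow_le_pow_left ih 56
          _ = (S.card ^ 56) ^ 55 ^ m := by rw [← pow_mul, ← pow_mul, mul_comm]
          _ ≤ ((S ^ k).card ^ 55) ^ 55 ^ m := Nat.pow_le_pow_left h _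
          _ = (S ^ k).card ^ 55 ^ (m + 1) := by rw [← pow_mul, ← pow_succ']

end Iteration

/-! ### From growth to diameter -/

section Diameter

theorem cayleyGraph_edist_le {G : Type*} [Group G] [DecidableEq G] {A : Set G} {H : Finset G}
    (hHA : ∀ h ∈ H, h = 1 ∨ h ∈ A ∨ h⁻¹ ∈ A) (n : ℕ) (g : G) (hg : g ∈ H ^ n) (v : G) :
    (cayleyGraph A).edist (g * v) v ≤ n := by
  induction n generalizing g with
  | zero =>
    have : g = 1 := by simpa using hg
    simp [this]
  | succ n ih =>
    rw [pow_succ', Finset.mem_mul] at hg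
    obtain ⟨h, hh, k, hk, rfl⟩ := hg
    refine ((cayleyGraph A).edist_triangle (v := k * v)).trans ?_
    have hstep : (cayleyGraph A).edist (h * k * v) (k * v) ≤ 1 := by
      by_cases heq : h * k * v = k * v
      · rw [heq]; simp
      · refine le_of_eq (SimpleGraph.edist_eq_one_iff_adj.2 ?_)
        rw [cayleyGraph, SimpleGraph.fromRel_adj]
        refine ⟨heq, ?_⟩
        rcases hHA h hh with h1 | h1 | h1
        · simp [h1] at heq
        · exact Or.inl ⟨h, h1, by group⟩
        · exact Or.inr ⟨h⁻¹, h1, by group⟩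
    refine (add_le_add hstep (ih k hk)).trans ?_
    push_cast
    rw [add_comm]

theorem cayleyGraph_diam_le {G : Type*} [Group G] [DecidableEq G] {A : Set G} {H : Finset G}
    (hHA : ∀ h ∈ H, h = 1 ∨ h ∈ A ∨ h⁻¹ ∈ A) {n : ℕ} (hg : ∀ g, g ∈ H ^ n) :
    (cayleyGraph A).diam ≤ n := by
  have : (cayleyGraph A).ediam ≤ n := by
    rw [SimpleGraph.ediam_le_iff]
    intro u v
    simpa using cayleyGraph_edist_le hHA n (u * v⁻¹) (hg _) v
  exact ENat.toNat_le_of_le_natCast this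

theorem card_sl2_le {F : Type*} [Field F] [Fintype F] [DecidableEq F] :
    Fintype.card SL(2, F) ≤ Fintype.card F ^ 4 := by
  refine (Fintype.card_le_of_injective
    (fun g : SL(2, F) => (g.1 0 0, g.1 0 1, g.1 1 0, g.1 1 1)) ?_).trans ?_
  · intro g h hgh
    simp only [Prod.mk.injEq] at hgh
    exact sl2_ext hgh.1 hgh.2.1 hgh.2.2.1 hgh.2.2.2
  · simp only [Fintype.card_prod]
    exact le_of_eq (by ring)

theorem exists_symmetric_finset {G : Type*} [Group G] [Finite G] {A : Set G}
    (hgen : Subgroup.closure A = ⊤) :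
    ∃ H : Finset G, H.map (Equiv.inv G).toEmbedding = H ∧ 1 ∈ H ∧
      Subgroup.closure (H : Set G) = ⊤ ∧ ∀ h ∈ H, h = 1 ∨ h ∈ A ∨ h⁻¹ ∈ A := by
  obtain ⟨H, hH⟩ := (Set.toFinite (A ∪ A⁻¹ ∪ {1})).exists_finset
  refine ⟨H, ?_, ?_, ?_, ?_⟩
  · ext h
    rw [Finset.mem_map_equiv]
    simp [hH, or_comm]
  · simp [hH]
  · rw [eq_top_iff, ← hgen]
    refine Subgroup.closure_mono fun a ha => Finset.mem_coe.2 ((hH a).2 (Or.inl (Or.inl ha)))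
  · intro h hh
    have := (hH h).1 hh
    simp only [Set.mem_union, Set.mem_inv, Set.mem_singleton_iff] at this
    tauto

/-- Take the first stage that fills the group. If it is `j + 1`, stage `j` did not fill it, so its
lower bound is at most a power of the group order, itself at most `p ^ 4`. -/
theorem exists_diam_le_or : ∃ k n₀ : ℕ, 1 < k ∧ ∀ (p : ℕ) [Fact p.Prime] (A : Set SL(2, ZMod p)),
    Subgroup.closure A = ⊤ → (cayleyGraph A).diam ≤ n₀ ∨
      ∃ j : ℕ, 2 ^ 56 ^ j ≤ (p ^ 4) ^ 55 ^ j ∧ (cayleyGraph A).diam ≤ n₀ * k ^ (j + 1) := by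
  obtain ⟨k, n₀, hk, hn81, hn₀⟩ := exists_iterated_growth
  refine ⟨k, n₀, hk, ?_⟩
  intro p hp A hgen
  obtain ⟨H, hH', h1, hHgen, hHA⟩ := exists_symmetric_finset hgen
  have hH : H⁻¹ = H := by
    ext h
    rw [Finset.mem_inv']
    nth_rewrite 2 [← hH']
    rw [Finset.mem_map_equiv]
    rfl
  have hcardG : Fintype.card SL(2, ZMod p) ≤ p ^ 4 := by
    have := card_sl2_le (F := ZMod p)
    rwa [ZMod.card] at this
  rcases Nat.lt_or_ge 3 p with hp3 | hp3
  · have hp23 : ∀ r : ℕ, 0 < r → r ≤ 3 → ((r : ℕ) : ZMod p) ≠ 0 := by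
      intro r hr hr3 h
      rw [ZMod.natCast_eq_zero_iff] at h
      have := Nat.le_of_dvd hr h
      omega
    have hmain := hn₀ (F := ZMod p) (by exact_mod_cast hp23 2 (by norm_num) (by norm_num))
      (by exact_mod_cast hp23 3 (by norm_num) (by norm_num)) H hH h1 hHgen
    have hbound : ∀ m : ℕ, ¬ (∀ g, g ∈ H ^ (n₀ * k ^ m)) → 2 ^ 56 ^ m ≤ (p ^ 4) ^ 55 ^ m := by
      intro m hm
      exact ((hmain m).resolve_left hm).1.trans
        (Nat.pow_le_pow_left ((Finset.card_le_univ _).trans hcardG) _)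
    by_cases hex : ∃ m : ℕ, ∀ g, g ∈ H ^ (n₀ * k ^ m)
    · classical
      obtain ⟨m, hm⟩ : ∃ m, m = Nat.find hex := ⟨_, rfl⟩
      have hspec : ∀ g, g ∈ H ^ (n₀ * k ^ m) := hm ▸ Nat.find_spec hex
      have hd := cayleyGraph_diam_le hHA hspec
      rcases m with _ | j
      · left
        simpa using hd
      · exact Or.inr ⟨j, hbound j (Nat.find_min hex (by omega)), hd⟩
    · exfalso
      push Not at hex
      rcases lt_card_pow_or_forall_mem hH h1 hHgen (p ^ 4) with h | h
      · exact absurd ((Finset.card_le_univ _).trans hcardG) (not_le.2 h)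
      · obtain ⟨g, hg⟩ := hex (p ^ 4)
        refine hg (Finset.pow_subset_pow_right h1 ?_ (h g))
        calc p ^ 4 ≤ k ^ (p ^ 4) := (Nat.lt_pow_self hk).le
          _ ≤ n₀ * k ^ (p ^ 4) := Nat.le_mul_of_pos_left _ (by omega)
  · left
    rcases lt_card_pow_or_forall_mem hH h1 hHgen n₀ with h | h
    · exfalso
      have h5 := (Finset.card_le_univ (H ^ n₀)).trans hcardG
      have h6 : p ^ 4 ≤ 3 ^ 4 := Nat.pow_le_pow_left hp3 4
      omega
    · exact cayleyGraph_diam_le hHA h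

/-- The diameters of the Cayley graphs of `SL₂(ℤ/pℤ)` are polylogarithmic. -/
theorem exists_isDiameterExponent : ∃ c : ℝ, IsDiameterExponent c := by
  obtain ⟨k, n₀, hk, hmain⟩ := exists_diam_le_or
  have hb : (0 : ℝ) < Real.log (56 / 55) := Real.log_pos (by norm_num)
  have hk1 : (1 : ℝ) < k := by exact_mod_cast hk
  have hk0 : (0 : ℝ) < k := by linarith
  have hl2 : (0 : ℝ) < Real.log 2 := Real.log_pos (by norm_num)
  -- Chosen so that `(56/55) ^ c = k`: the bound on `(56/55) ^ j` becomes one on `k ^ j`.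
  set c : ℝ := Real.log k / Real.log (56 / 55) with hc
  have hc0 : 0 < c := div_pos (Real.log_pos hk1) hb
  have hbc : ((56 / 55 : ℝ)) ^ c = k := by
    rw [Real.rpow_def_of_pos (by norm_num), hc, mul_div_cancel₀ _ hb.ne', Real.exp_log hk0]
  refine ⟨c, hc0, n₀ * k * (4 / Real.log 2) ^ c, ?_⟩
  intro p hp A hgen
  have hp2 : 2 ≤ p := hp.out.two_le
  have hlogp : Real.log 2 ≤ Real.log p := Real.log_le_log (by norm_num) (by exact_mod_cast hp2)
  have hlp : 0 < Real.log p := hl2.trans_le hlogp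
  rw [mul_assoc, ← Real.mul_rpow (by positivity) hlp.le, div_mul_eq_mul_div]
  have hbase : 1 ≤ 4 * Real.log p / Real.log 2 := by
    rw [le_div_iff₀ hl2]; linarith
  have hone : 1 ≤ (4 * Real.log p / Real.log 2) ^ c := Real.one_le_rpow hbase hc0.le
  have hmain' := hmain p A hgen
  generalize (cayleyGraph A).diam = D at hmain'
  rcases hmain' with hd | ⟨j, hj, hd⟩
  · have hd' : (D : ℝ) ≤ n₀ := by exact_mod_cast hd
    calc (D : ℝ) ≤ n₀ * 1 * 1 := by simpa using hd'
      _ ≤ _ := by gcongr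
  · have hd' : (D : ℝ) ≤ n₀ * k ^ (j + 1) := by exact_mod_cast hd
    have h4 : ((2 : ℝ)) ^ 56 ^ j ≤ ((p : ℝ) ^ 4) ^ 55 ^ j := by exact_mod_cast hj
    have h5 := Real.log_le_log (by positivity) h4
    rw [Real.log_pow, Real.log_pow, Real.log_pow] at h5
    push_cast at h5
    have h6 : ((56 / 55 : ℝ)) ^ j ≤ 4 * Real.log p / Real.log 2 := by
      rw [div_pow, div_le_div_iff₀ (by positivity) hl2]
      linarith
    have hkj : (k : ℝ) ^ j ≤ (4 * Real.log p / Real.log 2) ^ c := by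
      calc (k : ℝ) ^ j = (((56 / 55 : ℝ)) ^ c) ^ j := by rw [hbc]
        _ = (((56 / 55 : ℝ)) ^ j) ^ c := by
          rw [← Real.rpow_natCast, ← Real.rpow_natCast, ← Real.rpow_mul (by norm_num),
            ← Real.rpow_mul (by norm_num), mul_comm]
        _ ≤ _ := Real.rpow_le_rpow (by positivity) h6 hc0.le
    calc (D : ℝ) ≤ n₀ * k ^ (j + 1) := hd'
      _ = n₀ * k * k ^ j := by ring
      _ ≤ _ := by gcongr

end Diameter

/-! ### Poincaré inequality and the second eigenvalue -/

section Spectral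

variable {G : Type*} [Group G] [Fintype G]

/-- The squared `ℓ²` distance between `f` and its right translate by `g`. -/
def shiftEnergy (f : G → ℝ) (g : G) : ℝ := ∑ y, (f (y * g) - f y) ^ 2

theorem shiftEnergy_nonneg (f : G → ℝ) (g : G) : 0 ≤ shiftEnergy f g :=
  Finset.sum_nonneg fun _ _ => sq_nonneg _

theorem shiftEnergy_inv (f : G → ℝ) (g : G) : shiftEnergy f g⁻¹ = shiftEnergy f g := by
  unfold shiftEnergy
  rw [← Equiv.sum_comp (Equiv.mulRight g)]
  refine Finset.sum_congr rfl fun y _ => ?_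
  simp only [Equiv.coe_mulRight, mul_inv_cancel_right]
  ring

/-- Right translations are isometries of `ℓ²`, so the square root of the energy is subadditive. The
weighted inequality `(p - r)² ≤ (1 + 1/t)(p - q)² + (1 + t)(q - r)²` expresses this in squares. -/
theorem shiftEnergy_mul_le (f : G → ℝ) {a h : G} {M : ℝ} {n : ℕ} (ha : shiftEnergy f a ≤ M)
    (hh : shiftEnergy f h ≤ (n : ℝ) ^ 2 * M) :
    shiftEnergy f (a * h) ≤ ((n + 1 : ℕ) : ℝ) ^ 2 * M := by
  have key : ∀ t : ℝ, 0 < t → shiftEnergy f (a * h) ≤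
      (1 + 1 / t) * shiftEnergy f h + (1 + t) * shiftEnergy f a := by
    intro t ht
    have e : shiftEnergy f h = ∑ y, (f (y * a * h) - f (y * a)) ^ 2 := by
      unfold shiftEnergy
      rw [← Equiv.sum_comp (Equiv.mulRight a)]
      rfl
    rw [e]
    unfold shiftEnergy
    rw [Finset.mul_sum, Finset.mul_sum, ← Finset.sum_add_distrib]
    refine Finset.sum_le_sum fun y _ => ?_
    rw [← mul_assoc]
    generalize f (y * a * h) = p
    generalize f (y * a) = q
    generalize f y = r
    have h1 : (1 + 1 / t) * (p - q) ^ 2 + (1 + t) * (q - r) ^ 2 - (p - r) ^ 2 =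
        ((p - q) - t * (q - r)) ^ 2 / t := by
      field_simp
      ring
    have h2 : 0 ≤ ((p - q) - t * (q - r)) ^ 2 / t := by positivity
    linarith
  -- The optimal weight is `t = n`; for `n = 0` the energy of `h` vanishes and `t` tends to 0.
  rcases Nat.eq_zero_or_pos n with rfl | hn
  · have h0 : shiftEnergy f h = 0 := le_antisymm (by simpa using hh) (shiftEnergy_nonneg f h)
    simp only [h0, mul_zero, zero_add] at key
    simp only [zero_add, Nat.cast_one, one_pow, one_mul]
    refine le_trans ?_ ha
    refine le_of_forall_pos_le_add fun ε hε => ?_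
    have hA := shiftEnergy_nonneg f a
    refine (key (ε / (shiftEnergy f a + 1)) (by positivity)).trans ?_
    have : ε / (shiftEnergy f a + 1) * shiftEnergy f a ≤ ε := by
      rw [div_mul_eq_mul_div, div_le_iff₀ (by positivity)]
      nlinarith
    linarith
  · have hn' : (0 : ℝ) < n := by exact_mod_cast hn
    refine (key n hn').trans ?_
    calc (1 + 1 / (n : ℝ)) * shiftEnergy f h + (1 + n) * shiftEnergy f a
        ≤ (1 + 1 / (n : ℝ)) * ((n : ℝ) ^ 2 * M) + (1 + n) * M := by gcongr
      _ = ((n + 1 : ℕ) : ℝ) ^ 2 * M := by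
        push_cast
        field_simp
        ring

theorem shiftEnergy_walk_le (f : G → ℝ) {A : Set G} {M : ℝ} (hM : ∀ a ∈ A, shiftEnergy f a ≤ M)
    {u v : G} (w : (cayleyGraph A).Walk u v) :
    shiftEnergy f (u * v⁻¹) ≤ (w.length : ℝ) ^ 2 * M := by
  induction w with
  | nil => simp [shiftEnergy]
  | @cons u v z h w ih =>
    rw [SimpleGraph.Walk.length_cons, show u * z⁻¹ = (u * v⁻¹) * (v * z⁻¹) by group]
    refine shiftEnergy_mul_le f ?_ ih
    rw [cayleyGraph, SimpleGraph.fromRel_adj] at h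
    obtain ⟨-, ⟨a, ha, rfl⟩ | ⟨a, ha, rfl⟩⟩ := h
    · simpa using hM a ha
    · simpa [shiftEnergy_inv] using hM a ha

/-- Needed because `SimpleGraph.diam` takes the default value 0 when the extended diameter is
infinite. -/
theorem cayleyGraph_ediam_ne_top {A : Set G} (hgen : Subgroup.closure A = ⊤) :
    (cayleyGraph A).ediam ≠ ⊤ := by
  classical
  obtain ⟨H, hH', h1, hHgen, hHA⟩ := exists_symmetric_finset hgen
  have hH : H⁻¹ = H := by
    ext h
    rw [Finset.mem_inv']
    nth_rewrite 2 [← hH']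
    rw [Finset.mem_map_equiv]
    rfl
  rcases lt_card_pow_or_forall_mem hH h1 hHgen (Fintype.card G) with h | h
  · exact absurd (Finset.card_le_univ _) (not_le.2 h)
  · refine ne_top_of_le_ne_top (ENat.natCast_ne_top (Fintype.card G)) ?_
    rw [SimpleGraph.ediam_le_iff]
    intro u v
    simpa using cayleyGraph_edist_le hHA _ (u * v⁻¹) (h _) v

theorem shiftEnergy_le_diam (f : G → ℝ) {A : Set G} (hgen : Subgroup.closure A = ⊤) {M : ℝ}
    (hM0 : 0 ≤ M) (hM : ∀ a ∈ A, shiftEnergy f a ≤ M) (g : G) :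
    shiftEnergy f g ≤ ((cayleyGraph A).diam : ℝ) ^ 2 * M := by
  have htop := cayleyGraph_ediam_ne_top hgen
  obtain ⟨w, hw⟩ := (SimpleGraph.connected_of_ediam_ne_top htop).exists_walk_length_eq_dist g 1
  have h1 := shiftEnergy_walk_le f hM w
  rw [inv_one, mul_one, hw] at h1
  refine h1.trans ?_
  gcongr
  exact SimpleGraph.dist_le_diam htop

theorem sum_shiftEnergy (f : G → ℝ) (hf : ∑ x, f x = 0) :
    ∑ g, shiftEnergy f g = 2 * Fintype.card G * ∑ x, f x ^ 2 := by
  have e : ∀ y, ∑ g, (f (y * g) - f y) ^ 2 = ∑ x, f x ^ 2 + Fintype.card G * f y ^ 2 := by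
    intro y
    have := Equiv.sum_comp (Equiv.mulLeft y) fun x => (f x - f y) ^ 2
    simp only [Equiv.coe_mulLeft] at this
    rw [this]
    simp only [sub_sq, Finset.sum_add_distrib, Finset.sum_sub_distrib, ← Finset.sum_mul,
      ← Finset.mul_sum, hf]
    simp
  unfold shiftEnergy
  rw [Finset.sum_comm]
  simp only [e, Finset.sum_add_distrib, ← Finset.mul_sum]
  simp
  ring

theorem dirichlet_form (f ψ : G → ℝ) (hψ : ∑ g, ψ g = 1) :
    ∑ x, f x * (transitionMatrix ψ).mulVec f x =
      ∑ x, f x ^ 2 - (∑ g, ψ g * shiftEnergy f g) / 2 := by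
  have h1 : ∑ x, f x * (transitionMatrix ψ).mulVec f x = ∑ g, ψ g * ∑ y, f (y * g) * f y := by
    simp only [Matrix.mulVec, dotProduct, transitionMatrix, Matrix.of_apply, Finset.mul_sum]
    rw [Finset.sum_comm]
    rw [Finset.sum_comm (s := (Finset.univ : Finset G)) (t := (Finset.univ : Finset G))
      (f := fun g y => ψ g * (f (y * g) * f y))]
    refine Finset.sum_congr rfl fun y _ => ?_
    rw [← Equiv.sum_comp (Equiv.mulLeft y)]
    refine Finset.sum_congr rfl fun g _ => ?_
    simp only [Equiv.coe_mulLeft, inv_mul_cancel_left]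
    ring
  have h2 : ∀ g, shiftEnergy f g = 2 * ∑ x, f x ^ 2 - 2 * ∑ y, f (y * g) * f y := by
    intro g
    have := Equiv.sum_comp (Equiv.mulRight g) fun x => f x ^ 2
    simp only [Equiv.coe_mulRight] at this
    unfold shiftEnergy
    simp only [sub_sq, Finset.sum_add_distrib, Finset.sum_sub_distrib, this, mul_assoc,
      ← Finset.mul_sum]
    ring
  rw [h1]
  simp only [h2, mul_sub, Finset.sum_sub_distrib, ← Finset.sum_mul, hψ, mul_left_comm _ (2 : ℝ),
    ← Finset.mul_sum]
  ring

/-- Poincaré inequality: a lower bound for the Dirichlet form on mean-zero functions. -/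
theorem rayleigh_le (f ψ : G → ℝ) (hf : ∑ x, f x = 0) (hψ0 : ∀ g, 0 ≤ ψ g) (hψ : ∑ g, ψ g = 1)
    {A : Set G} (hgen : Subgroup.closure A = ⊤) {η : ℝ} (hη : 0 ≤ η) (hA : ∀ a ∈ A, η ≤ ψ a) :
    η * ∑ x, f x ^ 2 ≤ ((cayleyGraph A).diam : ℝ) ^ 2 *
      (∑ x, f x ^ 2 - ∑ x, f x * (transitionMatrix ψ).mulVec f x) := by
  rw [dirichlet_form f ψ hψ]
  set Q := ∑ g, ψ g * shiftEnergy f g with hQ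
  have hQ0 : 0 ≤ Q := Finset.sum_nonneg fun g _ => mul_nonneg (hψ0 g) (shiftEnergy_nonneg f g)
  rcases hη.eq_or_lt with rfl | hη
  · rw [zero_mul]
    have : 0 ≤ ((cayleyGraph A).diam : ℝ) ^ 2 * (Q / 2) := by positivity
    linarith
  -- One term of the nonnegative sum `Q` is at most `Q`, and its weight is at least `η`.
  have hM : ∀ a ∈ A, shiftEnergy f a ≤ Q / η := by
    intro a ha
    rw [le_div_iff₀ hη, mul_comm]
    refine (mul_le_mul_of_nonneg_right (hA a ha) (shiftEnergy_nonneg f a)).trans ?_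
    exact Finset.single_le_sum (f := fun g => ψ g * shiftEnergy f g)
      (fun g _ => mul_nonneg (hψ0 g) (shiftEnergy_nonneg f g)) (Finset.mem_univ a)
  have hsum := Finset.sum_le_card_nsmul Finset.univ (shiftEnergy f) _
    fun g _ => shiftEnergy_le_diam f hgen (div_nonneg hQ0 hη.le) hM g
  rw [sum_shiftEnergy f hf, nsmul_eq_mul, Finset.card_univ] at hsum
  have hG : (0 : ℝ) < Fintype.card G := by exact_mod_cast Fintype.card_pos
  generalize ((cayleyGraph A).diam : ℝ) ^ 2 = D at *
  generalize ∑ x, f x ^ 2 = E at *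
  have h3 : 2 * E ≤ D * (Q / η) := by
    refine le_of_mul_le_mul_left ?_ hG
    linarith
  have h4 : η * (2 * E) ≤ D * Q := by
    calc η * (2 * E) ≤ η * (D * (Q / η)) := by gcongr
      _ = D * Q := by field_simp
  linarith

/-- The second largest eigenvalue is at most the Rayleigh quotient of some mean-zero function. -/
theorem exists_rayleigh_ge {ι : Type*} [Fintype ι] [DecidableEq ι] [Nontrivial ι]
    {M : Matrix ι ι ℝ} (hM : M.IsHermitian) :
    ∃ f : ι → ℝ, ∑ x, f x = 0 ∧ 0 < ∑ x, f x ^ 2 ∧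
      secondLargestEigenvalue hM * ∑ x, f x ^ 2 ≤ ∑ x, f x * M.mulVec f x := by
  set e : Fin (Fintype.card ι) ≃ ι := Fintype.equivOfCardEq (Fintype.card_fin _) with he
  have hcard : 1 < Fintype.card ι := Fintype.one_lt_card
  set k₀ : Fin (Fintype.card ι) := ⟨0, by omega⟩
  set k₁ : Fin (Fintype.card ι) := ⟨1, hcard⟩
  have hval : ∀ k, hM.eigenvalues (e k) = hM.eigenvalues₀ k := fun k => by
    simp [Matrix.IsHermitian.eigenvalues, he]
  have hle : hM.eigenvalues₀ k₁ ≤ hM.eigenvalues₀ k₀ := hM.eigenvalues₀_antitone (by simp [k₀, k₁])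
  have horth : ∀ i j, ∑ x, hM.eigenvectorBasis i x * hM.eigenvectorBasis j x =
      if i = j then 1 else 0 := by
    intro i j
    rw [← orthonormal_iff_ite.1 hM.eigenvectorBasis.orthonormal i j, PiLp.inner_apply]
    refine Finset.sum_congr rfl fun x _ => ?_
    simp [mul_comm]
  obtain ⟨v, hv⟩ : ∃ v : ι → ℝ, v = ⇑(hM.eigenvectorBasis (e k₀)) := ⟨_, rfl⟩
  obtain ⟨w, hw⟩ : ∃ w : ι → ℝ, w = ⇑(hM.eigenvectorBasis (e k₁)) := ⟨_, rfl⟩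
  have hvv := horth (e k₀) (e k₀)
  have hww := horth (e k₁) (e k₁)
  have hvw := horth (e k₀) (e k₁)
  have hMv := hM.mulVec_eigenvectorBasis (e k₀)
  have hMw := hM.mulVec_eigenvectorBasis (e k₁)
  rw [if_neg (by simp [k₀, k₁])] at hvw
  simp only [if_true] at hvv hww
  rw [hval, ← hv] at hMv
  rw [hval, ← hw] at hMw
  simp only [← hv, ← hw] at hvv hww hvw
  -- The plane of the two top eigenvectors meets the mean-zero hyperplane, and every Rayleigh
  -- quotient on that plane is at least the second eigenvalue. The top eigenvector need not be
  -- identified as constant.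
  obtain ⟨a, b, hab0, hab⟩ : ∃ a b : ℝ, 0 < a ^ 2 + b ^ 2 ∧ a * ∑ x, v x + b * ∑ x, w x = 0 := by
    by_cases h0 : ∑ x, v x = 0
    · exact ⟨1, 0, by norm_num, by simp [h0]⟩
    · exact ⟨-∑ x, w x, ∑ x, v x, by positivity, by ring⟩
  have hsq : ∑ x, (a * v x + b * w x) ^ 2 = a ^ 2 + b ^ 2 := by
    calc ∑ x, (a * v x + b * w x) ^ 2
        = a ^ 2 * ∑ x, v x * v x + b ^ 2 * ∑ x, w x * w x + 2 * a * b * ∑ x, v x * w x := by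
          simp only [Finset.mul_sum, ← Finset.sum_add_distrib]
          exact Finset.sum_congr rfl fun x _ => by ring
      _ = _ := by rw [hvv, hww, hvw]; ring
  refine ⟨fun x => a * v x + b * w x, ?_, by rwa [hsq], ?_⟩
  · rw [Finset.sum_add_distrib, ← Finset.mul_sum, ← Finset.mul_sum, hab]
  have hMf : M.mulVec (fun x => a * v x + b * w x) =
      fun x => a * (hM.eigenvalues₀ k₀ * v x) + b * (hM.eigenvalues₀ k₁ * w x) := by
    rw [show (fun x => a * v x + b * w x) = a • v + b • w from rfl, Matrix.mulVec_add,
      Matrix.mulVec_smul, Matrix.mulVec_smul, hMv, hMw]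
    rfl
  rw [hsq, hMf]
  change hM.eigenvalues₀ k₁ * _ ≤ _
  generalize hM.eigenvalues₀ k₀ = l₀ at *
  generalize hM.eigenvalues₀ k₁ = l₁ at *
  calc l₁ * (a ^ 2 + b ^ 2) ≤ l₀ * a ^ 2 + l₁ * b ^ 2 := by nlinarith [sq_nonneg a]
    _ = a ^ 2 * l₀ * ∑ x, v x * v x + b ^ 2 * l₁ * ∑ x, w x * w x +
        a * b * (l₀ + l₁) * ∑ x, v x * w x := by rw [hvv, hww, hvw]; ring
    _ = _ := by
      simp only [Finset.mul_sum, ← Finset.sum_add_distrib]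
      exact Finset.sum_congr rfl fun x _ => by ring

end Spectral

end

/-! ### Combination of the two halves -/

theorem mainTheorem3 :
    (∃ c : ℝ, IsDiameterExponent c) ∧
    ∀ c : ℝ, IsDiameterExponent c →
      ∃ C : ℝ, 0 < C ∧
        ∀ (p : ℕ) [Fact p.Prime] (A : Set (Matrix.SpecialLinearGroup (Fin 2) (ZMod p))),
          Subgroup.closure A = ⊤ →
          ∀ ψ : Matrix.SpecialLinearGroup (Fin 2) (ZMod p) → ℝ,
            ψ ∈ stdSimplex ℝ (Matrix.SpecialLinearGroup (Fin 2) (ZMod p)) →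
            ∀ hsymm : ∀ g, ψ g = ψ g⁻¹,
              A ⊆ Function.support ψ →
              ∀ η : ℝ, IsLeast (ψ '' (A ∪ A⁻¹)) η →
                secondLargestEigenvalue (transitionMatrix_isHermitian hsymm) ≤
                  1 - C * η / Real.log p ^ (2 * c) := by
  refine ⟨exists_isDiameterExponent, ?_⟩
  rintro c ⟨hc, K, hK⟩
  -- The given `K` need not be positive; the maximum with 1 makes `1 / K' ^ 2` a positive constant.
  obtain ⟨K', hK'⟩ : ∃ K', K' = max K 1 := ⟨_, rfl⟩
  have hK1 : 0 < K' := by rw [hK']; exact lt_max_of_lt_right one_pos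
  refine ⟨1 / K' ^ 2, by positivity, ?_⟩
  intro p hp A hgen ψ hψ hsymm hsupp η hη
  have hlp : 0 < Real.log p := Real.log_pos (by exact_mod_cast hp.out.one_lt)
  have hη0 : 0 < η := by
    obtain ⟨a, ha, rfl⟩ := hη.1
    refine lt_of_le_of_ne (hψ.1 a) (Ne.symm ?_)
    rcases ha with ha | ha
    · exact hsupp ha
    · rw [hsymm]
      exact hsupp ha
  obtain ⟨f, hf0, hfpos, hfr⟩ := exists_rayleigh_ge (transitionMatrix_isHermitian hsymm)
  have hray := rayleigh_le f ψ hf0 hψ.1 hψ.2 hgen hη0.le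
    fun a ha => hη.2 (Set.mem_image_of_mem ψ (Or.inl ha))
  generalize secondLargestEigenvalue (transitionMatrix_isHermitian hsymm) = l at *
  have hD : ((cayleyGraph A).diam : ℝ) ^ 2 ≤ K' ^ 2 * Real.log p ^ (2 * c) := by
    have h1 : ((cayleyGraph A).diam : ℝ) ≤ K' * Real.log p ^ c := by
      refine (hK p A hgen).trans ?_
      gcongr
      rw [hK']
      exact le_max_left _ _
    calc ((cayleyGraph A).diam : ℝ) ^ 2 ≤ (K' * Real.log p ^ c) ^ 2 := by gcongr
      _ = K' ^ 2 * Real.log p ^ (2 * c) := by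
        rw [mul_pow, mul_comm 2 c, Real.rpow_mul hlp.le, Real.rpow_two]
  have hL : 0 < Real.log p ^ (2 * c) := Real.rpow_pos_of_pos hlp _
  generalize Real.log p ^ (2 * c) = L at *
  have hD0 : 0 ≤ ((cayleyGraph A).diam : ℝ) ^ 2 := by positivity
  generalize ((cayleyGraph A).diam : ℝ) ^ 2 = D at *
  have h2 : η ≤ D * (1 - l) := by
    refine le_of_mul_le_mul_right ?_ hfpos
    refine hray.trans ?_
    rw [mul_assoc]
    refine mul_le_mul_of_nonneg_left ?_ hD0
    linarith
  -- The sign allows `D` to be replaced by its upper bound in `η ≤ D (1 - l)`.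
  have hl : 0 ≤ 1 - l := by
    by_contra! hneg
    nlinarith
  have h3 : 1 / K' ^ 2 * η / L ≤ 1 - l := by
    rw [div_le_iff₀ hL, one_div, inv_mul_le_iff₀ (by positivity)]
    calc η ≤ D * (1 - l) := h2
      _ ≤ K' ^ 2 * L * (1 - l) := by gcongr
      _ = _ := by ring
  linarith
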